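/- **Setting.** Let $X$ be a standard Borel space and let $q\ge 1$ be an integer, identified with $\{0,\dots,q-1\}$. An $(X,q)$-constraint $B$ with finite domain $\mathrm{dom}(B)=D\subseteq X$ is a set $B\subseteq q^{D}$ of functions $D\to q$. A function $f\colon X\to q$ violates $B$ if $f|_{\mathrm{dom}(B)}\in B$, and satisfies $B$ otherwise. A constraint satisfaction problem (CSP) $\mathscr B\colon X\to^? q$ is a set of $(X,q)$-constraints; a solution to $\mathscr B$ is a function $f\colon X\to q$ that satisfies every $B\in\mathscr B$. Put $$\mathsf p(\mathscr B)=\sup_{B\in\mathscr B}\frac{|B|}{q^{|\mathrm{dom}(B)|}},\qquad \mathsf d(\mathscr B)=\sup_{B\in\mathscr B}\bigl|\{B'\in\mathscr B: B'\ne B,\ \mathrm{dom}(B')\cap\mathrm{dom}(B)\neq\varnothing\}\bigr|\in\mathbb N\cup\{\infty\},$$ where suprema over the empty set are $0$ and $0\cdot\infty=0$. The space $[X]^{<\infty}$ of finite subsets of $X$ carries the standard Borel structure of the disjoint union over $k\in\mathbb N$ of the quotients of the spaces of injective $k$-tuples in $X$ by permutation of the coordinates. A finite partial function $X\rightharpoonup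 q$ is identified with its graph, a finite subset of $X\times q$, and a constraint is identified with the pair consisting of its domain and its finite set of finite partial functions; this makes the set of all $(X,q)$-constraints a standard Borel space. The CSP $\mathscr B$ is Borel if it is a Borel subset of this space. The graph $G_{\mathscr B}$ has vertex set $X$, and distinct $x,y\in X$ are adjacent in it if and only if $x,y\in\mathrm{dom}(B)$ for some $B\in\mathscr B$. A graph on a standard Borel space is Borel if its adjacency relation is a Borel set of pairs; a Borel subgraph of it is a subgraph whose vertex set is Borel and which is itself a Borel graph. A Borel graph $G$ is hyperfinite if it is the union of an increasing sequence $G_0\subseteq G_1\subseteq\cdots\subseteq G$ of Borel subgraphs all of whose connected components are finite. **Corollary 1.18 (Measurable hyperfinite LLL).** Let $\mathscr B\colon X\to^? q$ be a Borel CSP on a standard Borel space $X$. Suppose that the graph $G_{\mathscr B}$ is hyperfinite and that $$\mathsf p(\mathscr B)\,(\mathsf d(\mathscr B)+1)^2\le e^{-2}.$$ If $\mu$ is a Borel probability measure on $X$, then $\mathscr B$ has a $\mu$-measurable solution, i.e., a solution $f\colon X\to q$ (satisfying every constraint in $\mathscr B$) such that $f^{-1}(i)$ is $\mu$-measurable (measurable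 with respect to the completion of $\mu$) for every $0\le i<q$. -/

import Mathlib

open scoped ENNReal

namespace BorelCSP

/-! ### Standard Borel structures on spaces of finite sets and of finite partial functions -/

/-- The space `[X]^{<∞}` of finite subsets of `X`. This is a type synonym of `Finset X`, because
the measurable structure that `Finset X` carries by default (generated by the sets
`{s | a ∈ s}`, `a ∈ X`) is not the Borel structure on `[X]^{<∞}` when `X` is uncountable. -/
def FinSets (X : Type*) : Type _ := Finset X

/-- A finite set as a point of `[X]^{<∞}`. -/
def FinSets.of {X : Type*} (s : Finset X) : FinSets X := s

/-- A point of `[X]^{<∞}` as a finite set. -/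
def FinSets.toFinset {X : Type*} (s : FinSets X) : Finset X := s

/-- The Borel structure on the space `[X]^{<∞}` of finite subsets of `X`. It is the disjoint union
over `k` of the quotients `[X]^k = (X)^k / ∼` of the spaces `(X)^k ⊆ X^k` of injective
`k`-tuples: a family of finite sets is Borel if and only if, for every `k`, its preimage under
`(x_0, …, x_{k-1}) ↦ {x_0, …, x_{k-1}}` is Borel in `(X)^k`. -/
instance FinSets.measurableSpace {X : Type*} [MeasurableSpace X] : MeasurableSpace (FinSets X) :=
  ⨅ k : ℕ, MeasurableSpace.map
    (fun x : {x : Fin k → X // Function.Injective x} =>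
      FinSets.of (Finset.univ.map ⟨x.1, x.2⟩)) inferInstance

theorem FinSets.measurableSet_iff {X : Type*} [MeasurableSpace X] (A : Set (FinSets X)) :
    MeasurableSet A ↔ ∀ k : ℕ, MeasurableSet
      {x : {x : Fin k → X // Function.Injective x} |
        FinSets.of (Finset.univ.map ⟨x.1, x.2⟩) ∈ A} :=
  MeasurableSpace.measurableSet_iInf

/-- Finite partial functions `X ⇀ q`, identified with their graphs, which are finite subsets of
`X × q`. The Borel structure is the one inherited from the space of finite subsets of `X × q`. -/
abbrev FinFun (X : Type*) (q : ℕ) : Type _ :=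
  {φ : FinSets (X × Fin q) // ∀ a ∈ φ.toFinset, ∀ b ∈ φ.toFinset, a.1 = b.1 → a.2 = b.2}

/-- The graph of a coloring of a finite set `D`, as a finite subset of `X × q`. -/
def graphFinset {X : Type*} {q : ℕ} (D : Finset X) (φ : {x // x ∈ D} → Fin q) :
    Finset (X × Fin q) :=
  D.attach.map ⟨fun x => (x.1, φ x), fun _ _ h => Subtype.ext (congrArg Prod.fst h)⟩

theorem mem_graphFinset {X : Type*} {q : ℕ} {D : Finset X} {φ : {x // x ∈ D} → Fin q}
    {a : X × Fin q} : a ∈ graphFinset D φ ↔ ∃ h : a.1 ∈ D, φ ⟨a.1, h⟩ = a.2 := by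
  obtain ⟨x, i⟩ := a
  constructor
  · intro h
    obtain ⟨y, -, hy⟩ := Finset.mem_map.1 h
    obtain ⟨rfl, rfl⟩ := Prod.ext_iff.1 hy
    exact ⟨y.2, rfl⟩
  · rintro ⟨h, hi⟩
    exact Finset.mem_map.2 ⟨⟨x, h⟩, Finset.mem_attach _ _, Prod.ext rfl hi⟩

/-- A coloring of a finite set `D`, viewed as a finite partial function on `X` (via its graph). -/
def graphFinFun {X : Type*} {q : ℕ} (D : Finset X) : ({x // x ∈ D} → Fin q) ↪ FinFun X q where
  toFun φ := ⟨FinSets.of (graphFinset D φ), by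
    rintro ⟨x, i⟩ ha ⟨y, j⟩ hb (rfl : x = y)
    obtain ⟨h, hi⟩ := mem_graphFinset.1 ha
    obtain ⟨_, hj⟩ := mem_graphFinset.1 hb
    exact hi.symm.trans hj⟩
  inj' φ ψ h := by
    funext x
    have h' : graphFinset D φ = graphFinset D ψ := congrArg Subtype.val h
    have hx : (x.1, φ x) ∈ graphFinset D ψ := h' ▸ mem_graphFinset.2 ⟨x.2, rfl⟩
    obtain ⟨_, hy⟩ := mem_graphFinset.1 hx
    exact hy.symm

/-! ### Constraints and constraint satisfaction problems -/

/-- An `(X, q)`-constraint: a finite set `dom ⊆ X` together with a set `bad` of `q`-colorings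
of `dom` (the forbidden patterns). -/
structure Constraint (X : Type*) (q : ℕ) where
  dom : Finset X
  bad : Finset ({x // x ∈ dom} → Fin q)

namespace Constraint

variable {X : Type*} {q : ℕ}

/-- A constraint coded as its domain together with its finite set of finite partial functions. -/
def code (B : Constraint X q) : FinSets X × FinSets (FinFun X q) :=
  (FinSets.of B.dom, FinSets.of (B.bad.map (graphFinFun B.dom)))

/-- The Borel structure on the space of constraints, inherited from
`[X]^{<∞} × [FinFun X q]^{<∞}` through the injective coding `Constraint.code`. -/
instance measurableSpace [MeasurableSpace X] : MeasurableSpace (Constraint X q) :=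
  MeasurableSpace.comap code inferInstance

theorem code_injective : Function.Injective (code : Constraint X q → _) := by
  rintro ⟨D, B⟩ ⟨D', B'⟩ h
  obtain rfl : D = D' := congrArg Prod.fst h
  have h2 : B.map (graphFinFun D) = B'.map (graphFinFun D) := congrArg Prod.snd h
  rw [Finset.map_injective _ h2]

/-- The coloring `f` violates `B`: its restriction to the domain of `B` is forbidden by `B`. -/
def Violates (f : X → Fin q) (B : Constraint X q) : Prop :=
  (fun x : {x // x ∈ B.dom} => f x) ∈ B.bad

/-- The probability `|B| / q ^ |dom B|` that a uniformly random `q`-coloring violates `B`. -/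
noncomputable def prob (B : Constraint X q) : ℝ≥0∞ :=
  (B.bad.card : ℝ≥0∞) / (q : ℝ≥0∞) ^ B.dom.card

end Constraint

/-- A constraint satisfaction problem on `X` with range `q` is a set of `(X, q)`-constraints. -/
abbrev CSP (X : Type*) (q : ℕ) : Type _ := Set (Constraint X q)

namespace CSP

variable {X : Type*} {q : ℕ}

/-- A CSP is Borel if it is a Borel set of constraints. -/
def IsBorel [MeasurableSpace X] (𝓑 : CSP X q) : Prop := MeasurableSet 𝓑

/-- A solution is a coloring that satisfies (does not violate) every constraint. -/
def IsSolution (𝓑 : CSP X q) (f : X → Fin q) : Prop := ∀ B ∈ 𝓑, ¬ B.Violates f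

/-- `p(𝓑)`, the supremum of the probabilities of the constraints in `𝓑`. -/
noncomputable def p (𝓑 : CSP X q) : ℝ≥0∞ := ⨆ B ∈ 𝓑, B.prob

/-- `d(𝓑)`, the maximum dependency degree: the supremum over `B ∈ 𝓑` of the number (possibly
infinite) of other constraints in `𝓑` whose domain meets that of `B`. -/
noncomputable def d (𝓑 : CSP X q) : ℕ∞ :=
  ⨆ B ∈ 𝓑, {B' ∈ 𝓑 | B ≠ B' ∧ ((B'.dom : Set X) ∩ (B.dom : Set X)).Nonempty}.encard

/-- The graph `G_𝓑`: distinct points are adjacent when they lie in the domain of a common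
constraint. -/
def graph (𝓑 : CSP X q) : SimpleGraph X where
  Adj x y := x ≠ y ∧ ∃ B ∈ 𝓑, x ∈ B.dom ∧ y ∈ B.dom
  symm := ⟨fun _ _ h => ⟨h.1.symm, h.2.imp fun _ hB => ⟨hB.1, hB.2.2, hB.2.1⟩⟩⟩
  loopless := ⟨fun _ h => h.1 rfl⟩

end CSP

/-! ### Borel graphs and hyperfiniteness -/

variable {X : Type*}

/-- A graph is component-finite if each of its connected components is finite. -/
def ComponentFinite (G : SimpleGraph X) : Prop :=
  ∀ c : G.ConnectedComponent, c.supp.Finite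

/-- A graph on a (standard Borel) space is Borel if its adjacency relation is a Borel set. -/
def IsBorelGraph [MeasurableSpace X] (G : SimpleGraph X) : Prop :=
  MeasurableSet {z : X × X | G.Adj z.1 z.2}

/-- A Borel subgraph: the vertex set is a Borel subset of the ambient space, and the subgraph,
as a graph on this set with the relative Borel structure, is Borel. -/
def IsBorelSubgraph [MeasurableSpace X] {G : SimpleGraph X} (H : G.Subgraph) : Prop :=
  MeasurableSet H.verts ∧ IsBorelGraph H.coe

/-- A Borel graph is hyperfinite if it is the union of an increasing sequence of component-finite
Borel subgraphs. -/
def IsHyperfinite [MeasurableSpace X] (G : SimpleGraph X) : Prop :=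
  IsBorelGraph G ∧ ∃ H : ℕ → G.Subgraph, Monotone H ∧
    (∀ n, IsBorelSubgraph (H n) ∧ ComponentFinite (H n).coe) ∧ ⨆ n, H n = ⊤

end BorelCSP

namespace BorelCSP

/-! ### The finite Lovász Local Lemma -/

section LocalLemma

variable {V κ ι : Type*} [Fintype V] [DecidableEq V] [Fintype κ] [DecidableEq κ]

/-! Write c = e(d+1), with d the dependency degree. When d is finite, the hypothesis says that every
constraint has probability at most 1/c². The coloring is built in two rounds on disjoint Borel sets
U 0 and U 1, each inducing a subgraph with finite components, whose union is conull and closed under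
adjacency. The first round colors U 0 so that all conditional probabilities stay below 1/c; the
second colors U 1 and brings them below 1. A constraint inside the union then has nothing random
left, so it is satisfied. Every other constraint lies in the null complement, where any solution
will do; one exists by compactness.

One round gains a factor c (`exists_overlay_condProb_lt`): if B has conditional probability at most
a, Markov's inequality bounds the chance that a random coloring of a finite set raises it to b by
a/b ≤ 1/c, and the finite Local Lemma avoids all these events. The choice is Borel
(`exists_measurable_condProb_lt`) because each finite component can take the first suitable coloring
from a fixed countable list; measurability rests on Borel projections with bounded sections.

For the two parts (`exists_two_parts`), let A n be the set of vertices with an edge outside the n-th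
finite-component subgraph. These sets decrease to the empty set, so some A (ν k) has a k-th
neighborhood of measure at most 2^{-k}. Fattening them gives sets V k that contain A (ν k), contain
the neighborhood of V (k+1), and have null intersection. Adjacent points leave the sequence V at the
same stage or at consecutive stages, so the even and the odd stages give U 0 and U 1. -/

/-- Events determined by complementary sets of coordinates are independent. -/
theorem card_inter_mul_card (T : Finset V) (A B : Finset (V → κ))
    (hA : ∀ φ ψ : V → κ, (∀ v ∈ T, φ v = ψ v) → φ ∈ A → ψ ∈ A)
    (hB : ∀ φ ψ : V → κ, (∀ v, v ∉ T → φ v = ψ v) → φ ∈ B → ψ ∈ B) :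
    (A ∩ B).card * Fintype.card (V → κ) = A.card * B.card := by
  rw [← Finset.card_univ, ← Finset.card_product, ← Finset.card_product]
  -- Exchanging the values of two colorings off T is an involution, and it carries (A ∩ B) × univ
  -- onto A × B.
  let F : (V → κ) × (V → κ) → (V → κ) × (V → κ) :=
    fun p => (T.piecewise p.1 p.2, T.piecewise p.2 p.1)
  have hF : ∀ p, F (F p) = p := by
    intro p
    ext v <;> by_cases hv : v ∈ T <;> simp [F, hv]
  refine Finset.card_bij' (fun p _ => F p) (fun p _ => F p) ?_ ?_ (fun p _ => hF p)
    (fun p _ => hF p)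
  · rintro ⟨φ, ψ⟩ h
    simp only [Finset.mem_product, Finset.mem_inter, Finset.mem_univ, and_true] at h ⊢
    exact ⟨hA φ _ (fun v hv => by simp [F, hv]) h.1, hB φ _ (fun v hv => by simp [F, hv]) h.2⟩
  · rintro ⟨φ, ψ⟩ h
    simp only [Finset.mem_product, Finset.mem_inter, Finset.mem_univ, and_true] at h ⊢
    exact ⟨hA φ _ (fun v hv => by simp [F, hv]) h.1, hB ψ _ (fun v hv => by simp [F, hv]) h.2⟩

/-- The colorings that avoid all the events `A j`, `j ∈ S`. -/
def avoiding (A : ι → Finset (V → κ)) (S : Finset ι) : Finset (V → κ) :=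
  Finset.univ.filter fun φ => ∀ j ∈ S, φ ∉ A j

theorem mem_avoiding {A : ι → Finset (V → κ)} {S : Finset ι} {φ : V → κ} :
    φ ∈ avoiding A S ↔ ∀ j ∈ S, φ ∉ A j := by
  simp [avoiding]

variable [DecidableEq ι]

/-- Chain rule: each further event of R removes at most a fraction x of the colorings that survive
so far. -/
theorem pow_mul_card_avoiding_le (A : ι → Finset (V → κ)) {x : ℝ} (hx : x < 1)
    (S R : Finset ι)
    (h : ∀ R' ⊆ R, ∀ j ∈ R, j ∉ R' →
      ((A j ∩ avoiding A (S ∪ R')).card : ℝ) ≤ x * (avoiding A (S ∪ R')).card) :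
    (1 - x) ^ R.card * ((avoiding A S).card : ℝ) ≤ (avoiding A (S ∪ R)).card := by
  induction R using Finset.induction_on with
  | empty => simp
  | insert j R hj ih =>
    have ih' := ih fun R' hR' k hk hk' =>
      h R' (hR'.trans (Finset.subset_insert _ _)) k (Finset.mem_insert_of_mem hk) hk'
    have h1 := h R (Finset.subset_insert _ _) j (Finset.mem_insert_self _ _) hj
    have h2 : (avoiding A (S ∪ R)).card =
        (A j ∩ avoiding A (S ∪ R)).card + (avoiding A (S ∪ insert j R)).card := by
      rw [← Finset.card_union_of_disjoint]
      · congr 1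
        ext φ
        simp only [Finset.mem_union, Finset.mem_inter, mem_avoiding, Finset.mem_insert]
        constructor
        · intro hφ
          by_cases hA : φ ∈ A j
          · exact Or.inl ⟨hA, hφ⟩
          · refine Or.inr ?_
            rintro k (hk | rfl | hk)
            exacts [hφ k (Or.inl hk), hA, hφ k (Or.inr hk)]
        · rintro (hφ | hφ) k (hk | hk)
          exacts [hφ.2 k (Or.inl hk), hφ.2 k (Or.inr hk), hφ k (Or.inl hk),
            hφ k (Or.inr (Or.inr hk))]
      · rw [Finset.disjoint_left]
        intro φ hφ hφ'
        exact mem_avoiding.1 hφ' j (by simp) (Finset.mem_inter.1 hφ).1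
    have h3 : ((avoiding A (S ∪ R)).card : ℝ) =
        (A j ∩ avoiding A (S ∪ R)).card + (avoiding A (S ∪ insert j R)).card := by
      exact_mod_cast h2
    rw [Finset.card_insert_of_notMem hj, pow_succ]
    nlinarith [mul_le_mul_of_nonneg_left ih' (sub_nonneg.2 hx.le)]

/-- The Lovász Local Lemma for uniformly random colorings of a finite set. -/
theorem exists_avoiding [Nonempty κ] (s : Finset ι) (A : ι → Finset (V → κ)) (D : ι → Finset V)
    (hD : ∀ i, ∀ φ ψ : V → κ, (∀ v ∈ D i, φ v = ψ v) → φ ∈ A i → ψ ∈ A i)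
    {x : ℝ} (hx0 : 0 ≤ x) (hx1 : x < 1) (d : ℕ)
    (hA : ∀ i ∈ s, ((A i).card : ℝ) ≤ x * (1 - x) ^ d * Fintype.card (V → κ))
    (hd : ∀ i ∈ s, (s.filter fun j => j ≠ i ∧ ¬ Disjoint (D j) (D i)).card ≤ d) :
    ∃ φ : V → κ, ∀ i ∈ s, φ ∉ A i := by
  have hT : (0 : ℝ) < Fintype.card (V → κ) := by exact_mod_cast Fintype.card_pos
  -- Conditioned on avoiding any S, the event i has probability at most x. Bayes' rule splits S into
  -- S₁, which shares coordinates with i, and S₂, which is independent of i. The at most d events of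
  -- S₁ cost a factor (1 - x) ^ d by induction, which the bound on `A i` pays for.
  have key : ∀ S ⊆ s, ∀ i ∈ s, i ∉ S →
      ((A i ∩ avoiding A S).card : ℝ) ≤ x * (avoiding A S).card := by
    intro S
    induction S using Finset.strongInduction with
    | H S ih =>
      intro hS i hi hiS
      set S₁ := S.filter fun j => ¬ Disjoint (D j) (D i) with hS₁
      set S₂ := S.filter fun j => Disjoint (D j) (D i) with hS₂
      have hSS : S₂ ∪ S₁ = S := Finset.filter_union_filter_not_eq _ _
      have hd₁ : S₁.card ≤ d := by
        refine le_trans (Finset.card_le_card ?_) (hd i hi)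
        intro j hj
        rw [hS₁, Finset.mem_filter] at hj
        exact Finset.mem_filter.2 ⟨hS hj.1, fun h => hiS (h ▸ hj.1), hj.2⟩
      have h1 : (1 - x) ^ S₁.card * ((avoiding A S₂).card : ℝ) ≤ (avoiding A S).card := by
        rw [← hSS]
        refine pow_mul_card_avoiding_le A hx1 S₂ S₁ ?_
        intro R hR j hj hjR
        have hjS₂ : j ∉ S₂ := by
          simp only [hS₁, hS₂, Finset.mem_filter] at hj ⊢
          tauto
        have hsub : S₂ ∪ R ⊆ S := hSS ▸ Finset.union_subset_union_right hR
        have hjS : j ∈ S := hSS ▸ Finset.mem_union_right _ hj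
        have hjn : j ∉ S₂ ∪ R := by simp [hjS₂, hjR]
        exact ih _ ((Finset.ssubset_iff_of_subset hsub).2 ⟨j, hjS, hjn⟩) (hsub.trans hS) j
          (hS hjS) hjn
      have h2 : (A i ∩ avoiding A S₂).card * Fintype.card (V → κ) =
          (A i).card * (avoiding A S₂).card := by
        refine card_inter_mul_card (D i) _ _ (hD i) ?_
        intro φ ψ h hφ
        rw [mem_avoiding] at hφ ⊢
        intro j hj hψ
        refine hφ j hj (hD j ψ φ (fun v hv => (h v ?_).symm) hψ)
        exact Finset.disjoint_left.1 (Finset.mem_filter.1 hj).2 hv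
      have h2' : ((A i ∩ avoiding A S₂).card : ℝ) * Fintype.card (V → κ) =
          (A i).card * (avoiding A S₂).card := by exact_mod_cast h2
      have h3 : ((A i ∩ avoiding A S₂).card : ℝ) ≤ x * (1 - x) ^ d * (avoiding A S₂).card := by
        refine le_of_mul_le_mul_right ?_ hT
        rw [h2']
        calc ((A i).card : ℝ) * (avoiding A S₂).card
            ≤ (x * (1 - x) ^ d * Fintype.card (V → κ)) * (avoiding A S₂).card :=
              mul_le_mul_of_nonneg_right (hA i hi) (Nat.cast_nonneg _)
          _ = _ := by ring
      have h4 : (A i ∩ avoiding A S).card ≤ (A i ∩ avoiding A S₂).card := by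
        refine Finset.card_le_card (Finset.inter_subset_inter_left ?_)
        intro φ hφ
        rw [mem_avoiding] at hφ ⊢
        exact fun j hj => hφ j (Finset.mem_filter.1 hj).1
      have h5 : (1 - x) ^ d ≤ (1 - x) ^ S₁.card :=
        pow_le_pow_of_le_one (by linarith) (by linarith) hd₁
      calc ((A i ∩ avoiding A S).card : ℝ) ≤ (A i ∩ avoiding A S₂).card := by exact_mod_cast h4
        _ ≤ x * ((1 - x) ^ d * (avoiding A S₂).card) := by rw [← mul_assoc]; exact h3
        _ ≤ x * ((1 - x) ^ S₁.card * (avoiding A S₂).card) := by gcongr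
        _ ≤ x * (avoiding A S).card := by gcongr
  have h6 : (1 - x) ^ s.card * ((avoiding A ∅).card : ℝ) ≤ (avoiding A (∅ ∪ s)).card := by
    refine pow_mul_card_avoiding_le A hx1 ∅ s ?_
    intro R hR j hj hjR
    rw [Finset.empty_union]
    exact key R hR j hj hjR
  have h7 : avoiding A ∅ = (Finset.univ : Finset (V → κ)) := by ext; simp [mem_avoiding]
  rw [h7, Finset.card_univ, Finset.empty_union] at h6
  have h8 : (0 : ℝ) < (avoiding A s).card :=
    lt_of_lt_of_le (mul_pos (pow_pos (by linarith) _) hT) h6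
  obtain ⟨φ, hφ⟩ := Finset.card_pos.1 (by exact_mod_cast h8 : 0 < (avoiding A s).card)
  exact ⟨φ, mem_avoiding.1 hφ⟩

end LocalLemma

/-- The usual weight 1/(d+1) works because (1 + 1/d)^d ≤ e. At d = 0 it would equal 1, so 1/2 is
used instead, with e ≥ 2. -/
theorem exists_local_lemma_weight (d : ℕ) :
    ∃ x : ℝ, 0 ≤ x ∧ x < 1 ∧ 1 / (Real.exp 1 * (d + 1)) ≤ x * (1 - x) ^ d := by
  rcases Nat.eq_zero_or_pos d with rfl | hd
  · refine ⟨1 / 2, by norm_num, by norm_num, ?_⟩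
    have h := Real.add_one_le_exp (1 : ℝ)
    norm_num at h ⊢
    exact (inv_anti₀ (by norm_num) h).trans_eq (by norm_num)
  · have hd' : (0 : ℝ) < d := by exact_mod_cast hd
    refine ⟨1 / (d + 1), by positivity, ?_, ?_⟩
    · rw [div_lt_one (by positivity)]; linarith
    · have h1 : 1 - 1 / ((d : ℝ) + 1) = (1 + 1 / (d : ℝ))⁻¹ := by
        field_simp
        ring
      have h2 : (1 + 1 / (d : ℝ)) ^ d ≤ Real.exp 1 := by
        have h := Real.add_one_le_exp (1 / (d : ℝ))
        calc (1 + 1 / (d : ℝ)) ^ d ≤ Real.exp (1 / d) ^ d := by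
              gcongr; linarith
          _ = Real.exp 1 := by
              rw [← Real.exp_nat_mul]
              congr 1
              field_simp
      rw [h1, inv_pow, mul_comm, one_div, mul_inv, ← one_div ((d : ℝ) + 1), mul_comm]
      rw [mul_comm]
      gcongr

/-! ### Conditional probabilities of constraints under partial colorings -/

section CondProb

open scoped Classical

variable {X : Type*} {q : ℕ}

/-- The forbidden patterns of `B` that agree with `f` on `S`. -/
noncomputable def Constraint.agreeing (B : Constraint X q) (f : X → Fin q) (S : Set X) :
    Finset ({x // x ∈ B.dom} → Fin q) :=
  B.bad.filter fun φ => ∀ x, x.1 ∈ S → φ x = f x.1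

/-- The probability that `B` is violated by the coloring that equals `f` on `S` and is uniformly
random off `S`. -/
noncomputable def Constraint.condProb (B : Constraint X q) (f : X → Fin q) (S : Set X) : ℝ :=
  ((B.agreeing f S).card : ℝ) / (q : ℝ) ^ (B.dom.filter fun x => x ∉ S).card

namespace Constraint

/-- Locality: this bounds the coordinates on which the Local Lemma events depend, and lets colorings
chosen separately on components be glued. -/
theorem condProb_congr (B : Constraint X q) {f g : X → Fin q} {S T : Set X}
    (hS : ∀ x ∈ B.dom, x ∈ S ↔ x ∈ T) (hf : ∀ x ∈ B.dom, x ∈ S → f x = g x) :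
    B.condProb f S = B.condProb g T := by
  have h1 : B.agreeing f S = B.agreeing g T := by
    refine Finset.filter_congr fun φ _ => forall_congr' fun x => ?_
    constructor
    · intro h hx
      have hx' := (hS _ x.2).2 hx
      rw [h hx', hf _ x.2 hx']
    · intro h hx
      rw [h ((hS _ x.2).1 hx), hf _ x.2 hx]
  have h2 : (B.dom.filter fun x => x ∉ S) = B.dom.filter fun x => x ∉ T :=
    Finset.filter_congr fun x hx => not_congr (hS x hx)
  rw [condProb, condProb, h1, h2]

theorem condProb_empty (B : Constraint X q) (f : X → Fin q) :
    B.condProb f ∅ = (B.bad.card : ℝ) / (q : ℝ) ^ B.dom.card := by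
  simp [condProb, agreeing]

theorem prob_eq_ofReal (hq : 0 < q) (B : Constraint X q) :
    B.prob = ENNReal.ofReal ((B.bad.card : ℝ) / (q : ℝ) ^ B.dom.card) := by
  have hq' : (0 : ℝ) < q := by exact_mod_cast hq
  rw [prob, ENNReal.ofReal_div_of_pos (by positivity), ENNReal.ofReal_natCast,
    ENNReal.ofReal_pow hq'.le, ENNReal.ofReal_natCast]

/-- With no random variable left the denominator is 1, so the conditional probability is a natural
number and must vanish. -/
theorem not_violates_of_condProb_lt_one (B : Constraint X q) {f : X → Fin q} {S : Set X}
    (hS : ∀ x ∈ B.dom, x ∈ S) (h : B.condProb f S < 1) : ¬ B.Violates f := by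
  intro hv
  have h1 : (B.dom.filter fun x => x ∉ S) = ∅ := by
    rw [Finset.filter_eq_empty_iff]
    exact fun x hx hx' => hx' (hS x hx)
  rw [condProb, h1, Finset.card_empty, pow_zero, div_one] at h
  have h2 : 0 < (B.agreeing f S).card :=
    Finset.card_pos.2 ⟨_, Finset.mem_filter.2 ⟨hv, fun _ _ => rfl⟩⟩
  have h3 : (B.agreeing f S).card < 1 := by exact_mod_cast h
  omega

/-- The coloring that equals `c` on `C` and `f` off `C`. -/
noncomputable def overlay (f : X → Fin q) (C : Finset X) (c : {x // x ∈ C} → Fin q) : X → Fin q :=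
  fun x => if h : x ∈ C then c ⟨x, h⟩ else f x

theorem overlay_of_mem {f : X → Fin q} {C : Finset X} {c : {x // x ∈ C} → Fin q} {x : X}
    (h : x ∈ C) : overlay f C c x = c ⟨x, h⟩ := dif_pos h

theorem overlay_of_notMem {f : X → Fin q} {C : Finset X} {c : {x // x ∈ C} → Fin q} {x : X}
    (h : x ∉ C) : overlay f C c x = f x := dif_neg h

/-- Agreement with φ fixes the coordinates in D ∩ C and leaves those in C \ D free. -/
theorem card_overlay_agree (D C : Finset X) (φ : {x // x ∈ D} → Fin q) :
    ((Finset.univ.filter fun c : {x // x ∈ C} → Fin q =>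
      ∀ x : {x // x ∈ C}, ∀ h : x.1 ∈ D, φ ⟨x.1, h⟩ = c x).card : ℝ) *
      (q : ℝ) ^ (D ∩ C).card = (q : ℝ) ^ C.card := by
  have h1 : (Finset.univ.filter fun c : {x // x ∈ C} → Fin q =>
      ∀ x : {x // x ∈ C}, ∀ h : x.1 ∈ D, φ ⟨x.1, h⟩ = c x) =
      Fintype.piFinset fun x : {x // x ∈ C} =>
        if h : x.1 ∈ D then {φ ⟨x.1, h⟩} else Finset.univ := by
    ext c
    simp only [Finset.mem_filter, Finset.mem_univ, true_and, Fintype.mem_piFinset]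
    refine forall_congr' fun x => ?_
    by_cases h : x.1 ∈ D <;> simp [h, eq_comm]
  have h2 : (Fintype.piFinset fun x : {x // x ∈ C} =>
        if h : x.1 ∈ D then {φ ⟨x.1, h⟩} else Finset.univ).card = q ^ (C \ D).card := by
    rw [Fintype.card_piFinset]
    have h3 : ∀ x : {x // x ∈ C}, (if h : x.1 ∈ D then {φ ⟨x.1, h⟩} else Finset.univ :
        Finset (Fin q)).card = if x.1 ∈ D then 1 else q := by
      intro x
      by_cases h : x.1 ∈ D <;> simp [h]
    simp only [h3]
    rw [Finset.univ_eq_attach, Finset.prod_attach C (fun x => if x ∈ D then 1 else q),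
      Finset.prod_ite, Finset.prod_const_one, one_mul, Finset.prod_const,
      Finset.filter_notMem_eq_sdiff]
  have h4 : (C \ D).card + (D ∩ C).card = C.card := by
    rw [Finset.inter_comm]; exact Finset.card_sdiff_add_card_inter C D
  rw [h1, h2, Nat.cast_pow, ← pow_add, h4]

/-- The average of the conditional probabilities is the conditional probability. -/
theorem sum_condProb_overlay (hq : 0 < q) (B : Constraint X q) (f : X → Fin q) {S : Set X}
    {C : Finset X} (hSC : ∀ x ∈ C, x ∉ S) :
    ∑ c : {x // x ∈ C} → Fin q, B.condProb (overlay f C c) (S ∪ C) =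
      (q : ℝ) ^ C.card * B.condProb f S := by
  have hq' : (0 : ℝ) < q := by exact_mod_cast hq
  have hag : ∀ c : {x // x ∈ C} → Fin q, B.agreeing (overlay f C c) (S ∪ C) =
      (B.agreeing f S).filter
        fun φ => ∀ x : {x // x ∈ C}, ∀ h : x.1 ∈ B.dom, φ ⟨x.1, h⟩ = c x := by
    intro c
    ext φ
    simp only [agreeing, Finset.mem_filter, and_assoc]
    refine and_congr_right fun _ => ?_
    constructor
    · intro h
      refine ⟨fun x hx => ?_, fun x hx => ?_⟩
      · rw [h x (Or.inl hx), overlay_of_notMem fun hC => hSC _ hC hx]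
      · rw [h ⟨x.1, hx⟩ (Or.inr x.2), overlay_of_mem x.2]
    · rintro ⟨h1, h2⟩ x hx
      by_cases hC : x.1 ∈ C
      · rw [overlay_of_mem hC]; exact h2 ⟨x.1, hC⟩ x.2
      · rw [overlay_of_notMem hC]
        exact h1 x (hx.resolve_right hC)
  have hcard : (B.dom.filter fun x => x ∉ S).card =
      (B.dom.filter fun x => x ∉ S ∪ (C : Set X)).card + (B.dom ∩ C).card := by
    rw [← Finset.card_union_of_disjoint]
    · congr 1
      ext x
      have := hSC x
      simp only [Finset.mem_filter, Finset.mem_union, Finset.mem_inter, Set.mem_union,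
        Finset.mem_coe]
      tauto
    · rw [Finset.disjoint_left]
      intro x hx hx'
      exact (Finset.mem_filter.1 hx).2 (Or.inr (Finset.mem_inter.1 hx').2)
  have hsum : ∑ c : {x // x ∈ C} → Fin q, ((B.agreeing (overlay f C c) (S ∪ C)).card : ℝ) =
      ∑ φ ∈ B.agreeing f S, ((Finset.univ.filter fun c : {x // x ∈ C} → Fin q =>
        ∀ x : {x // x ∈ C}, ∀ h : x.1 ∈ B.dom, φ ⟨x.1, h⟩ = c x).card : ℝ) := by
    simp only [hag, Finset.card_filter, Nat.cast_sum]
    rw [Finset.sum_comm]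
  simp only [condProb]
  rw [← Finset.sum_div, hsum, hcard, pow_add, div_eq_iff (by positivity)]
  have hE := fun φ : {x // x ∈ B.dom} → Fin q => card_overlay_agree B.dom C φ
  have h5 : ∀ φ : {x // x ∈ B.dom} → Fin q,
      ((Finset.univ.filter fun c : {x // x ∈ C} → Fin q =>
        ∀ x : {x // x ∈ C}, ∀ h : x.1 ∈ B.dom, φ ⟨x.1, h⟩ = c x).card : ℝ) =
        (q : ℝ) ^ C.card / (q : ℝ) ^ (B.dom ∩ C).card := fun φ => by
    rw [eq_div_iff (by positivity)]; exact hE φ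
  simp only [h5, Finset.sum_const, nsmul_eq_mul]
  field_simp
  congr!

/-- A coloring of a finite set that keeps all conditional probabilities below `b`. -/
theorem exists_overlay_condProb_lt (hq : 0 < q) (𝓕 : Finset (Constraint X q)) (f : X → Fin q)
    {S : Set X} {C : Finset X} (hSC : ∀ x ∈ C, x ∉ S) {a b : ℝ} (d : ℕ) (hb : 0 < b)
    (ha : ∀ B ∈ 𝓕, B.condProb f S ≤ a) (hab : a * (Real.exp 1 * (d + 1)) ≤ b)
    (hd : ∀ B ∈ 𝓕, (𝓕.filter fun B' => B' ≠ B ∧ ¬ Disjoint B'.dom B.dom).card ≤ d) :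
    ∃ c : {x // x ∈ C} → Fin q, ∀ B ∈ 𝓕, B.condProb (overlay f C c) (S ∪ C) < b := by
  have : Nonempty (Fin q) := ⟨⟨0, hq⟩⟩
  obtain ⟨x, hx0, hx1, hx⟩ := exists_local_lemma_weight d
  have hT : (Fintype.card ({x // x ∈ C} → Fin q) : ℝ) = (q : ℝ) ^ C.card := by simp
  refine (exists_avoiding 𝓕
    (fun B => Finset.univ.filter fun c : {x // x ∈ C} → Fin q =>
      b ≤ B.condProb (overlay f C c) (S ∪ C))
    (fun B => Finset.univ.filter fun v => v.1 ∈ B.dom) ?_ hx0 hx1 d ?_ ?_).imp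
    fun c hc B hB => by simpa using hc B hB
  · intro B φ ψ h hφ
    simp only [Finset.mem_filter, Finset.mem_univ, true_and] at h hφ ⊢
    refine hφ.trans_eq (B.condProb_congr (fun _ _ => Iff.rfl) fun x hx _ => ?_)
    by_cases hC : x ∈ C
    · rw [overlay_of_mem hC, overlay_of_mem hC]; exact h _ hx
    · rw [overlay_of_notMem hC, overlay_of_notMem hC]
  · intro B hB
    set A := Finset.univ.filter fun c : {x // x ∈ C} → Fin q =>
      b ≤ B.condProb (overlay f C c) (S ∪ C) with hA
    -- Markov's inequality, the mean being the conditional probability before C is colored.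
    have h1 : (A.card : ℝ) * b ≤ (q : ℝ) ^ C.card * a := by
      calc (A.card : ℝ) * b = ∑ c ∈ A, b := by rw [Finset.sum_const, nsmul_eq_mul]
        _ ≤ ∑ c ∈ A, B.condProb (overlay f C c) (S ∪ C) :=
            Finset.sum_le_sum fun c hc => (Finset.mem_filter.1 hc).2
        _ ≤ ∑ c, B.condProb (overlay f C c) (S ∪ C) :=
            Finset.sum_le_sum_of_subset_of_nonneg (Finset.subset_univ _)
              fun _ _ _ => by unfold condProb; positivity
        _ = (q : ℝ) ^ C.card * B.condProb f S := sum_condProb_overlay hq B f hSC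
        _ ≤ _ := by gcongr; exact ha B hB
    have h2 : a ≤ b * (x * (1 - x) ^ d) := by
      calc a ≤ b * (1 / (Real.exp 1 * (d + 1))) := by
            rw [mul_one_div, le_div_iff₀ (by positivity)]; exact hab
        _ ≤ _ := by gcongr
    rw [hT]
    refine le_of_mul_le_mul_right (h1.trans ?_) hb
    calc (q : ℝ) ^ C.card * a ≤ (q : ℝ) ^ C.card * (b * (x * (1 - x) ^ d)) := by gcongr
      _ = _ := by ring
  · intro B hB
    refine le_trans (Finset.card_le_card ?_) (hd B hB)
    intro B' hB'
    simp only [Finset.mem_filter, Finset.not_disjoint_iff, Finset.mem_univ, true_and] at hB' ⊢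
    obtain ⟨h1, h2, v, hv, hv'⟩ := hB'
    exact ⟨h1, h2, v.1, hv, hv'⟩

end Constraint

end CondProb

/-! ### Borel projections along bounded sections -/

/-- A Borel set whose sections have at most `k` points has a Borel projection. -/
theorem measurableSet_fst_image_of_encard_le {X Y : Type*} [MeasurableSpace X]
    [StandardBorelSpace X] [MeasurableSpace Y] [StandardBorelSpace Y] (k : ℕ) :
    ∀ R : Set (X × Y), MeasurableSet R → (∀ x, {y | (x, y) ∈ R}.encard ≤ k) →
      MeasurableSet (Prod.fst '' R) := by
  obtain ⟨e, he⟩ := MeasureTheory.exists_measurableEmbedding_real Y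
  induction k with
  | zero =>
    intro R _ hk
    have : R = ∅ := by
      ext ⟨x, y⟩
      have h : {y | (x, y) ∈ R} = ∅ := by simpa using hk x
      simpa using Set.eq_empty_iff_forall_notMem.1 h y
    simp [this]
  | succ k ih =>
    intro R hR hk
    -- P lists full sections of k + 1 points in the order pulled back from ℝ. A section has only one
    -- increasing list, so the projection is injective on P and its image is Borel by Lusin–Souslin.
    -- Over the remaining points sections have at most k elements.
    set P : Set (X × (Fin (k + 1) → Y)) :=
      {p | (∀ i, (p.1, p.2 i) ∈ R) ∧ StrictMono fun i => e (p.2 i)} with hP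
    have hPm : MeasurableSet P := by
      have h2 : P = (⋂ i, (fun p : X × (Fin (k + 1) → Y) => (p.1, p.2 i)) ⁻¹' R) ∩
          ⋂ i, ⋂ j, ⋂ _ : i < j, {p | e (p.2 i) < e (p.2 j)} := by
        ext p
        simp [hP, StrictMono]
      rw [h2]
      refine (MeasurableSet.iInter fun i => ?_).inter
        (MeasurableSet.iInter fun i => MeasurableSet.iInter fun j => MeasurableSet.iInter fun _ => ?_)
      · exact (by fun_prop : Measurable fun p : X × (Fin (k + 1) → Y) => (p.1, p.2 i)) hR
      · have := he.measurable
        exact measurableSet_lt (by fun_prop) (by fun_prop)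
    have hrange : ∀ p ∈ P, Set.range p.2 = {y | (p.1, y) ∈ R} := by
      intro p hp
      have hinj : Function.Injective p.2 := Function.Injective.of_comp (f := e) hp.2.injective
      refine Set.Finite.eq_of_subset_of_encard_le' (Set.finite_of_encard_le_coe (hk p.1)) ?_ ?_
      · rintro _ ⟨i, rfl⟩; exact hp.1 i
      · rw [← Set.image_univ, hinj.encard_image]
        simpa using hk p.1
    have hT : MeasurableSet (Prod.fst '' P) := by
      refine hPm.image_of_measurable_injOn measurable_fst ?_
      rintro ⟨x, z⟩ hp ⟨x', z'⟩ hp' (rfl : x = x')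
      have h3 : (fun i => e (z i)) = fun i => e (z' i) := by
        refine (StrictMono.range_inj hp.2 hp'.2).1 ?_
        rw [Set.range_comp' e z, Set.range_comp' e z', hrange _ hp, hrange _ hp']
      ext1
      · rfl
      · exact funext fun i => he.injective (congrFun h3 i)
    have hR' := ih (R \ Prod.fst ⁻¹' (Prod.fst '' P)) (hR.diff (measurable_fst hT)) ?_
    · have h4 : Prod.fst '' R = Prod.fst '' P ∪ Prod.fst '' (R \ Prod.fst ⁻¹' (Prod.fst '' P)) := by
        ext x
        constructor
        · rintro ⟨⟨x, y⟩, h, rfl⟩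
          by_cases hx : x ∈ Prod.fst '' P
          · exact Or.inl hx
          · exact Or.inr ⟨(x, y), ⟨h, hx⟩, rfl⟩
        · rintro (⟨p, hp, rfl⟩ | ⟨p, hp, rfl⟩)
          · exact ⟨_, hp.1 0, rfl⟩
          · exact ⟨p, hp.1, rfl⟩
      rw [h4]
      exact hT.union hR'
    · intro x
      by_contra! hlt
      have h5 : ((k + 1 : ℕ) : ℕ∞) ≤ {y | (x, y) ∈ R \ Prod.fst ⁻¹' (Prod.fst '' P)}.encard :=
        Order.add_one_le_of_lt hlt
      obtain ⟨t, ht, htc⟩ := Set.exists_subset_encard_eq h5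
      have htf : t.Finite := Set.finite_of_encard_eq_coe htc
      have hcard : (htf.toFinset.image e).card = k + 1 := by
        rw [Finset.card_image_of_injective _ he.injective]
        rw [htf.encard_eq_coe_toFinset_card] at htc
        exact_mod_cast htc
      have h6 : ∀ i, ∃ y ∈ t, e y = (htf.toFinset.image e).orderEmbOfFin hcard i := by
        intro i
        obtain ⟨y, hy, hye⟩ := Finset.mem_image.1
          (Finset.orderEmbOfFin_mem (htf.toFinset.image e) hcard i)
        exact ⟨y, htf.mem_toFinset.1 hy, hye⟩
      choose z hz hze using h6
      have h7 : (x, z) ∈ P := by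
        refine ⟨fun i => (ht (hz i)).1, fun i j hij => ?_⟩
        simp only [hze]
        exact ((htf.toFinset.image e).orderEmbOfFin hcard).strictMono hij
      exact (ht (hz 0)).2 ⟨_, h7, rfl⟩

/-- There is a countable family of Borel colorings that extends every coloring of every finite
set. -/
theorem exists_countable_extending {X : Type*} [MeasurableSpace X] [StandardBorelSpace X]
    {q : ℕ} (hq : 0 < q) : ∃ h : ℕ → X → Fin q, (∀ n, Measurable (h n)) ∧
      ∀ (C : Finset X) (c : X → Fin q), ∃ n, ∀ x ∈ C, h n x = c x := by
  classical
  have : Nonempty (Fin q) := ⟨⟨0, hq⟩⟩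
  -- Countably many colorings: those that read only the first N bits of an injective Borel map into
  -- the Cantor space.
  let ι := Σ N : ℕ, ((Fin N → Bool) → Fin q)
  obtain ⟨s, hs⟩ := exists_surjective_nat ι
  let r : (N : ℕ) → X → (Fin N → Bool) := fun N x i => MeasurableSpace.mapNatBool X x i
  have hr : ∀ N, Measurable (r N) := fun N => by
    refine measurable_pi_lambda _ fun i => ?_
    exact (measurable_pi_apply _).comp (MeasurableSpace.measurable_mapNatBool X)
  let H : ι → X → Fin q := fun j x => j.2 (r j.1 x)
  refine ⟨fun n => H (s n), fun n => ?_, fun C c => ?_⟩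
  · exact (measurable_of_countable _).comp (hr _)
  · have h1 : ∀ x y : X, ∃ k, x ≠ y →
        MeasurableSpace.mapNatBool X x k ≠ MeasurableSpace.mapNatBool X y k := by
      intro x y
      by_cases hxy : x = y
      · exact ⟨0, fun h => absurd hxy h⟩
      · have h2 : MeasurableSpace.mapNatBool X x ≠ MeasurableSpace.mapNatBool X y :=
          fun h => hxy (MeasurableSpace.injective_mapNatBool X h)
        obtain ⟨k, hk⟩ := Function.ne_iff.1 h2
        exact ⟨k, fun _ => hk⟩
    choose k hk using h1
    let N := (C ×ˢ C).sup (fun p => k p.1 p.2) + 1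
    have hinj : Set.InjOn (r N) C := by
      intro x hx y hy hxy
      by_contra hne
      have h3 : k x y < N := Nat.lt_succ_of_le
        (Finset.le_sup (f := fun p : X × X => k p.1 p.2) (Finset.mk_mem_product hx hy))
      exact hk x y hne (congrFun hxy ⟨k x y, h3⟩)
    obtain ⟨n, hn⟩ := hs ⟨N, fun b => if hb : ∃ x ∈ C, r N x = b then c hb.choose
      else Classical.arbitrary _⟩
    refine ⟨n, fun x hx => ?_⟩
    have hb : ∃ x' ∈ C, r N x' = r N x := ⟨x, hx, rfl⟩
    change H (s n) x = c x
    rw [hn]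
    simp only [H, dif_pos hb]
    rw [hinj hb.choose_spec.1 hx hb.choose_spec.2]

/-! ### Coding constraints by injective tuples -/

section Coding

open scoped Classical

variable {X : Type*} {q : ℕ}

/-- Injective `m`-tuples. -/
abbrev InjTuple (X : Type*) (m : ℕ) : Type _ := {t : Fin m → X // Function.Injective t}

/-- The finite set of the entries of an injective tuple. -/
def InjTuple.entries {m : ℕ} (t : InjTuple X m) : Finset X := Finset.univ.map ⟨t.1, t.2⟩

theorem InjTuple.mem_entries {m : ℕ} {t : InjTuple X m} {x : X} :
    x ∈ t.entries ↔ ∃ i, t.1 i = x := by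
  simp [entries]

theorem InjTuple.apply_mem_entries {m : ℕ} (t : InjTuple X m) (i : Fin m) :
    t.1 i ∈ t.entries := mem_entries.2 ⟨i, rfl⟩

theorem InjTuple.measurable_entries [MeasurableSpace X] {m : ℕ} :
    Measurable fun t : InjTuple X m => FinSets.of t.entries := fun _ hA =>
  (FinSets.measurableSet_iff _).1 hA m

namespace Constraint

/-- The constraint whose domain is enumerated by `t` and whose patterns, read along `t`, are those
in `β`. -/
noncomputable def ofTuple {m : ℕ} (t : InjTuple X m) (β : Finset (Fin m → Fin q)) :
    Constraint X q where
  dom := t.entries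
  bad := Finset.univ.filter fun ψ => (fun i => ψ ⟨t.1 i, t.apply_mem_entries i⟩) ∈ β

theorem mem_bad_ofTuple {m : ℕ} {t : InjTuple X m} {β : Finset (Fin m → Fin q)}
    {ψ : {x // x ∈ t.entries} → Fin q} :
    ψ ∈ (ofTuple t β).bad ↔ (fun i => ψ ⟨t.1 i, t.apply_mem_entries i⟩) ∈ β :=
  Finset.mem_filter.trans (and_iff_right (Finset.mem_univ _))

theorem exists_coloring_entries {m : ℕ} (t : InjTuple X m) (φ : Fin m → Fin q) :
    ∃ ψ : {x // x ∈ t.entries} → Fin q, ∀ i, ψ ⟨t.1 i, t.apply_mem_entries i⟩ = φ i := by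
  refine ⟨fun x => φ (InjTuple.mem_entries.1 x.2).choose, fun i => ?_⟩
  have h := (InjTuple.mem_entries.1 (t.apply_mem_entries i)).choose_spec
  exact congrArg φ (t.2 h)

/-- A pattern on the domain extends to all of X by a default color. Testing on global colorings
avoids transporting patterns along `hdom`. -/
theorem eq_of_violates_iff (hq : 0 < q) {B B' : Constraint X q} (hdom : B.dom = B'.dom)
    (h : ∀ f : X → Fin q, B.Violates f ↔ B'.Violates f) : B = B' := by
  obtain ⟨D, P⟩ := B
  obtain ⟨D', P'⟩ := B'
  obtain rfl : D = D' := hdom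
  congr 1
  ext ψ
  have h1 := h fun x => if hx : x ∈ D then ψ ⟨x, hx⟩ else ⟨0, hq⟩
  simpa [Violates] using h1

/-- Enumerating the domain places every constraint in one of countably many families (m, β), each
parametrized by injective tuples. -/
theorem exists_ofTuple (hq : 0 < q) (B : Constraint X q) :
    ∃ (m : ℕ) (β : Finset (Fin m → Fin q)) (t : InjTuple X m), ofTuple t β = B := by
  let e := B.dom.equivFin
  let t : InjTuple X B.dom.card :=
    ⟨fun i => (e.symm i).1, Subtype.val_injective.comp e.symm.injective⟩
  have hdom : t.entries = B.dom := by
    ext x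
    rw [InjTuple.mem_entries]
    constructor
    · rintro ⟨i, rfl⟩; exact (e.symm i).2
    · intro hx; exact ⟨e ⟨x, hx⟩, by simp [t]⟩
  refine ⟨B.dom.card, Finset.univ.filter fun φ => (fun x => φ (e x)) ∈ B.bad, t,
    eq_of_violates_iff hq hdom fun f => ?_⟩
  refine mem_bad_ofTuple.trans ?_
  simp [Violates, t]

theorem graphFinset_entries {m : ℕ} (t : InjTuple X m) (ψ : {x // x ∈ t.entries} → Fin q) :
    graphFinset t.entries ψ = InjTuple.entries (⟨fun i =>
      (t.1 i, ψ ⟨t.1 i, t.apply_mem_entries i⟩), fun _ _ h => t.2 (congrArg Prod.fst h)⟩ :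
      InjTuple (X × Fin q) m) := by
  ext ⟨x, j⟩
  refine mem_graphFinset.trans (Iff.trans ?_ InjTuple.mem_entries.symm)
  constructor
  · rintro ⟨h, hj⟩
    obtain ⟨i, rfl⟩ := InjTuple.mem_entries.1 h
    exact ⟨i, Prod.ext rfl hj⟩
  · rintro ⟨i, hi⟩
    obtain ⟨rfl, rfl⟩ := Prod.ext_iff.1 hi
    exact ⟨t.apply_mem_entries i, rfl⟩

/-- The finite partial function that takes the entries of `t` to the colors listed in `φ`. -/
noncomputable def tupleFinFun {m : ℕ} (t : InjTuple X m) (φ : Fin m → Fin q) : FinFun X q :=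
  graphFinFun t.entries (exists_coloring_entries t φ).choose

theorem tupleFinFun_apply {m : ℕ} (t : InjTuple X m) (ψ : {x // x ∈ t.entries} → Fin q) :
    tupleFinFun t (fun i => ψ ⟨t.1 i, t.apply_mem_entries i⟩) = graphFinFun t.entries ψ := by
  rw [tupleFinFun]
  congr 1
  have h := (exists_coloring_entries t (fun i => ψ ⟨t.1 i, t.apply_mem_entries i⟩)).choose_spec
  ext ⟨x, hx⟩
  obtain ⟨i, rfl⟩ := InjTuple.mem_entries.1 hx
  rw [h i]

theorem tupleFinFun_injective {m : ℕ} (t : InjTuple X m) :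
    Function.Injective (tupleFinFun t : (Fin m → Fin q) → FinFun X q) := by
  intro φ φ' h
  have h1 := (graphFinFun t.entries).injective h
  ext1 i
  rw [← (exists_coloring_entries t φ).choose_spec i, h1,
    (exists_coloring_entries t φ').choose_spec i]

theorem measurable_tupleFinFun [MeasurableSpace X] {m : ℕ} (φ : Fin m → Fin q) :
    Measurable fun t : InjTuple X m => tupleFinFun t φ := by
  let G : InjTuple X m → InjTuple (X × Fin q) m := fun t =>
    ⟨fun i => (t.1 i, φ i), fun _ _ h => t.2 (congrArg Prod.fst h)⟩
  have hG : Measurable G := by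
    refine Measurable.subtype_mk (measurable_pi_lambda _ fun i => ?_)
    exact ((measurable_pi_apply i).comp measurable_subtype_coe).prodMk measurable_const
  have h1 : ∀ t : InjTuple X m, (tupleFinFun t φ).1 = FinSets.of (G t).entries := by
    intro t
    change graphFinset t.entries _ = _
    rw [graphFinset_entries]
    simp only [(exists_coloring_entries t φ).choose_spec]
    rfl
  refine measurable_comap_iff.2 ?_
  have h2 : Subtype.val ∘ (fun t : InjTuple X m => tupleFinFun t φ) =
      fun t => FinSets.of (G t).entries := funext h1
  rw [h2]
  exact InjTuple.measurable_entries.comp hG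

/-- Both components of the code are entry sets of injective tuples that depend measurably on t: t
itself, and the list of the partial functions coming from β, which are distinct and so always number
`β.card`. -/
theorem measurable_ofTuple [MeasurableSpace X] {m : ℕ} (β : Finset (Fin m → Fin q)) :
    Measurable fun t : InjTuple X m => ofTuple t β := by
  let G : InjTuple X m → InjTuple (FinFun X q) β.card := fun t =>
    ⟨fun j => tupleFinFun t (β.equivFin.symm j).1,
      (tupleFinFun_injective t).comp (Subtype.val_injective.comp β.equivFin.symm.injective)⟩
  have hG : Measurable G :=
    Measurable.subtype_mk (measurable_pi_lambda _ fun j => measurable_tupleFinFun _)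
  have h1 : ∀ t : InjTuple X m,
      (ofTuple t β).code = (FinSets.of t.entries, FinSets.of (G t).entries) := by
    intro t
    refine Prod.ext rfl ?_
    change (ofTuple t β).bad.map (graphFinFun t.entries) = (G t).entries
    ext y
    refine Finset.mem_map.trans (Iff.trans ?_ InjTuple.mem_entries.symm)
    constructor
    · rintro ⟨ψ, hψ, rfl⟩
      replace hψ := mem_bad_ofTuple.1 hψ
      refine ⟨β.equivFin ⟨_, hψ⟩, ?_⟩
      simp only [G, Equiv.symm_apply_apply]
      exact tupleFinFun_apply t ψ
    · rintro ⟨j, rfl⟩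
      refine ⟨(exists_coloring_entries t (β.equivFin.symm j).1).choose, ?_, rfl⟩
      refine mem_bad_ofTuple.2 ?_
      simp only [(exists_coloring_entries t (β.equivFin.symm j).1).choose_spec]
      exact (β.equivFin.symm j).2
  refine measurable_comap_iff.2 ?_
  have h2 : code ∘ (fun t : InjTuple X m => ofTuple t β) =
      fun t => (FinSets.of t.entries, FinSets.of (G t).entries) := funext h1
  rw [h2]
  exact InjTuple.measurable_entries.prodMk (InjTuple.measurable_entries.comp hG)

theorem condProb_ofTuple {m : ℕ} (t : InjTuple X m) (β : Finset (Fin m → Fin q)) (f : X → Fin q)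
    (S : Set X) : (ofTuple t β).condProb f S =
      ((β.filter fun φ => ∀ i, t.1 i ∈ S → φ i = f (t.1 i)).card : ℝ) /
        (q : ℝ) ^ (Finset.univ.filter fun i => t.1 i ∉ S).card := by
  have h1 : ((ofTuple t β).agreeing f S).card =
      (β.filter fun φ => ∀ i, t.1 i ∈ S → φ i = f (t.1 i)).card := by
    refine Finset.card_bij (fun ψ _ i => ψ ⟨t.1 i, t.apply_mem_entries i⟩) ?_ ?_ ?_
    · intro ψ hψ
      obtain ⟨h, h'⟩ := Finset.mem_filter.1 hψ
      exact Finset.mem_filter.2 ⟨mem_bad_ofTuple.1 h, fun i => h' ⟨t.1 i, t.apply_mem_entries i⟩⟩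
    · intro ψ _ ψ' _ h
      ext1 ⟨x, hx⟩
      obtain ⟨i, rfl⟩ := InjTuple.mem_entries.1 hx
      exact congrFun h i
    · intro φ hφ
      obtain ⟨h, h'⟩ := Finset.mem_filter.1 hφ
      obtain ⟨ψ, hψ⟩ := exists_coloring_entries t φ
      refine ⟨ψ, Finset.mem_filter.2 ⟨mem_bad_ofTuple.2 ?_, ?_⟩, funext hψ⟩
      · rwa [funext hψ]
      · rintro ⟨x, hx⟩ hxS
        obtain ⟨i, rfl⟩ := InjTuple.mem_entries.1 hx
        exact (hψ i).trans (h' i hxS)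
  have h2 : ((ofTuple t β).dom.filter fun x => x ∉ S) =
      (Finset.univ.filter fun i => t.1 i ∉ S).map ⟨t.1, t.2⟩ := by
    change (Finset.univ.map _).filter _ = _
    rw [Finset.filter_map]
    rfl
  rw [condProb, h1, h2, Finset.card_map]

/-- The value depends on t only through the finite data of which entries lie in S and which colors f
gives them. -/
theorem measurable_condProb_ofTuple [MeasurableSpace X] {m : ℕ} (β : Finset (Fin m → Fin q))
    {f : X → Fin q} (hf : Measurable f) {S : Set X} (hS : MeasurableSet S) :
    Measurable fun t : InjTuple X m => (ofTuple t β).condProb f S := by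
  let data : InjTuple X m → (Fin m → Fin q × Prop) := fun t i => (f (t.1 i), t.1 i ∈ S)
  have hdata : Measurable data := by
    refine measurable_pi_lambda _ fun i => ?_
    have hi : Measurable fun t : InjTuple X m => t.1 i :=
      (measurable_pi_apply i).comp measurable_subtype_coe
    exact (hf.comp hi).prodMk (measurableSet_setOfPred.1 (hi hS))
  have h1 : (fun t : InjTuple X m => (ofTuple t β).condProb f S) =
      (fun z : Fin m → Fin q × Prop =>
        ((β.filter fun φ => ∀ i, (z i).2 → φ i = (z i).1).card : ℝ) /
        (q : ℝ) ^ (Finset.univ.filter fun i => ¬ (z i).2).card) ∘ data :=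
    funext fun t => condProb_ofTuple t β f S
  rw [h1]
  exact (measurable_of_countable _).comp hdata

end Constraint

/-- Borel conditions on constraints can be quantified over the constraints through a point. -/
theorem CSP.measurableSet_exists_mem_dom [MeasurableSpace X] [StandardBorelSpace X] (hq : 0 < q)
    {𝓑 : CSP X q} (h𝓑 : 𝓑.IsBorel) (d : ℕ) (hd : ∀ x, {B ∈ 𝓑 | x ∈ B.dom}.encard ≤ d)
    (P : X → Constraint X q → Prop)
    (hP : ∀ (m : ℕ) (β : Finset (Fin m → Fin q)),
      MeasurableSet {z : X × InjTuple X m | P z.1 (Constraint.ofTuple z.2 β)}) :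
    MeasurableSet {x | ∃ B ∈ 𝓑, x ∈ B.dom ∧ P x B} := by
  have h1 : {x | ∃ B ∈ 𝓑, x ∈ B.dom ∧ P x B} = ⋃ m : ℕ, ⋃ β : Finset (Fin m → Fin q),
      Prod.fst '' {z : X × InjTuple X m | Constraint.ofTuple z.2 β ∈ 𝓑 ∧ (∃ i, z.2.1 i = z.1) ∧
        P z.1 (Constraint.ofTuple z.2 β)} := by
    ext x
    simp only [Set.mem_iUnion]
    constructor
    · rintro ⟨B, hB, hx, hxB⟩
      obtain ⟨m, β, t, rfl⟩ := Constraint.exists_ofTuple hq B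
      exact ⟨m, β, (x, t), ⟨hB, InjTuple.mem_entries.1 hx, hxB⟩, rfl⟩
    · rintro ⟨m, β, ⟨x, t⟩, ⟨hB, hx, hxB⟩, rfl⟩
      exact ⟨_, hB, InjTuple.mem_entries.2 hx, hxB⟩
  rw [h1]
  refine MeasurableSet.iUnion fun m => MeasurableSet.iUnion fun β => ?_
  have hinj : MeasurableSet {t : Fin m → X | Function.Injective t} := by
    have h2 : {t : Fin m → X | Function.Injective t} =
        ⋂ i, ⋂ j, ⋂ _ : i ≠ j, {t | t i = t j}ᶜ := by
      ext t
      simp only [Set.mem_ofPred_eq, Set.mem_iInter, Set.mem_compl_iff]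
      exact ⟨fun h i j hij h' => hij (h h'), fun h i j h' => by_contra fun hij => h i j hij h'⟩
    rw [h2]
    refine MeasurableSet.iInter fun i => MeasurableSet.iInter fun j => MeasurableSet.iInter
      fun _ => (measurableSet_eq_fun (by fun_prop) (by fun_prop)).compl
  have : StandardBorelSpace (InjTuple X m) := hinj.standardBorel
  -- At most d constraints contain x, and a domain of size m carries at most m ^ m tuples of length
  -- m.
  refine measurableSet_fst_image_of_encard_le (d * m ^ m) _ ?_ ?_
  · have h3 : MeasurableSet {z : X × InjTuple X m | ∃ i, z.2.1 i = z.1} := by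
      have h4 : {z : X × InjTuple X m | ∃ i, z.2.1 i = z.1} = ⋃ i, {z | z.2.1 i = z.1} := by
        ext; simp
      rw [h4]
      refine MeasurableSet.iUnion fun i => measurableSet_eq_fun ?_ measurable_fst
      exact (measurable_pi_apply i).comp (measurable_subtype_coe.comp measurable_snd)
    exact (((Constraint.measurable_ofTuple β).comp measurable_snd) h𝓑).inter (h3.inter (hP m β))
  · intro x
    have hfin : {B ∈ 𝓑 | x ∈ B.dom}.Finite := Set.finite_of_encard_le_coe (hd x)
    set F := hfin.toFinset.filter fun B => B.dom.card = m with hF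
    have hFd : F.card ≤ d := by
      refine (Finset.card_filter_le _ _).trans ?_
      have := hd x
      rw [hfin.encard_eq_coe_toFinset_card] at this
      exact_mod_cast this
    have h5 : ((fun t : InjTuple X m => t.1) '' {t | (x, t) ∈ {z : X × InjTuple X m |
        Constraint.ofTuple z.2 β ∈ 𝓑 ∧ (∃ i, z.2.1 i = z.1) ∧ P z.1 (Constraint.ofTuple z.2 β)}}) ⊆
        ((F.biUnion fun B => Fintype.piFinset fun _ : Fin m => B.dom : Finset (Fin m → X)) :
          Set (Fin m → X)) := by
      rintro _ ⟨t, ⟨hB, hx, -⟩, rfl⟩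
      simp only [Finset.coe_biUnion, Set.mem_iUnion]
      refine ⟨Constraint.ofTuple t β, ?_, ?_⟩
      · simp only [hF, Finset.coe_filter, Set.Finite.mem_toFinset, Set.mem_ofPred_eq]
        refine ⟨⟨hB, InjTuple.mem_entries.2 hx⟩, ?_⟩
        simp [Constraint.ofTuple, InjTuple.entries]
      · exact Finset.mem_coe.2 (Fintype.mem_piFinset.2 fun i => t.apply_mem_entries i)
    have h6 : (F.biUnion fun B => Fintype.piFinset fun _ : Fin m => B.dom).card ≤ d * m ^ m := by
      refine (Finset.card_biUnion_le_card_mul F _ (m ^ m) fun B hB => ?_).trans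
        (Nat.mul_le_mul_right _ hFd)
      rw [Fintype.card_piFinset_const, (Finset.mem_filter.1 hB).2]
    rw [← Subtype.val_injective.encard_image]
    refine (Set.encard_le_encard h5).trans ?_
    rw [Set.encard_coe_eq_coe_finsetCard]
    exact_mod_cast h6

end Coding

/-! ### Neighborhoods and components in induced subgraphs -/

section Graphs

variable {X : Type*}

/-- The points that lie in `Z` or have a `G`-neighbor in `Z`. -/
def nbhd (G : SimpleGraph X) (Z : Set X) : Set X := {x | x ∈ Z ∨ ∃ y ∈ Z, G.Adj x y}

theorem subset_nbhd (G : SimpleGraph X) (Z : Set X) : Z ⊆ nbhd G Z := fun _ => Or.inl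

theorem nbhd_mono (G : SimpleGraph X) : Monotone (nbhd G) := fun _ _ h _ hx =>
  hx.imp (fun hx => h hx) fun ⟨y, hy, hxy⟩ => ⟨y, h hy, hxy⟩

/-- `x` and `y` are adjacent in the subgraph of `G` induced by `U`. -/
def InducedAdj (G : SimpleGraph X) (U : Set X) (x y : X) : Prop := G.Adj x y ∧ x ∈ U ∧ y ∈ U

/-- `x` and `y` are joined by a walk of `G` inside `U`, or equal. -/
abbrev Joined (G : SimpleGraph X) (U : Set X) : X → X → Prop :=
  Relation.ReflTransGen (InducedAdj G U)

theorem Joined.symm {G : SimpleGraph X} {U : Set X} {x y : X} (h : Joined G U x y) :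
    Joined G U y x := by
  induction h with
  | refl => exact Relation.ReflTransGen.refl
  | tail _ h ih => exact Relation.ReflTransGen.head ⟨h.1.symm, h.2.2, h.2.1⟩ ih

theorem Joined.mem {G : SimpleGraph X} {U : Set X} {x y : X} (h : Joined G U x y) (hx : x ∈ U) :
    y ∈ U := by
  induction h with
  | refl => exact hx
  | tail _ h _ => exact h.2.2

/-- The points that are joined to a point of `Z` inside `U`. -/
def saturation (G : SimpleGraph X) (U Z : Set X) : Set X := {x | ∃ z ∈ Z, Joined G U x z}

/-- The saturation is the countable union of the sets reached from Z by k steps of taking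
neighborhoods inside U. -/
theorem measurableSet_saturation [MeasurableSpace X] {G : SimpleGraph X}
    (hG : ∀ Z, MeasurableSet Z → MeasurableSet (nbhd G Z)) {U Z : Set X} (hU : MeasurableSet U)
    (hZ : MeasurableSet Z) (hZU : Z ⊆ U) : MeasurableSet (saturation G U Z) := by
  let Φ : Set X → Set X := fun Y => nbhd G Y ∩ U
  have hm : ∀ k, MeasurableSet (Φ^[k] Z) := by
    intro k
    induction k with
    | zero => exact hZ
    | succ k ih =>
      rw [Function.iterate_succ_apply']
      exact (hG _ ih).inter hU
  have hsub : ∀ k, Φ^[k] Z ⊆ U := by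
    intro k
    cases k with
    | zero => exact hZU
    | succ k =>
      rw [Function.iterate_succ_apply']
      exact Set.inter_subset_right
  have h1 : saturation G U Z = ⋃ k, Φ^[k] Z := by
    ext x
    rw [Set.mem_iUnion]
    constructor
    · rintro ⟨z, hz, h⟩
      induction h using Relation.ReflTransGen.head_induction_on with
      | refl => exact ⟨0, hz⟩
      | head h _ ih =>
        obtain ⟨k, hk⟩ := ih
        refine ⟨k + 1, ?_⟩
        rw [Function.iterate_succ_apply']
        exact ⟨Or.inr ⟨_, hk, h.1⟩, h.2.1⟩
    · rintro ⟨k, hk⟩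
      induction k generalizing x with
      | zero => exact ⟨x, hk, Relation.ReflTransGen.refl⟩
      | succ k ih =>
        rw [Function.iterate_succ_apply'] at hk
        obtain ⟨hk | ⟨y, hy, hxy⟩, hxU⟩ := hk
        · exact ih x hk
        · obtain ⟨z, hz, h⟩ := ih y hy
          exact ⟨z, hz, Relation.ReflTransGen.head ⟨hxy, hxU, hsub k hy⟩ h⟩
  rw [h1]
  exact MeasurableSet.iUnion hm

end Graphs

/-! ### Constraint satisfaction problems of bounded degree -/

namespace CSP

variable {X : Type*} {q : ℕ}

/-- Every constraint of `𝓑` shares variables with at most `d` others. -/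
def DegreeLE (𝓑 : CSP X q) (d : ℕ) : Prop :=
  ∀ B ∈ 𝓑, {B' ∈ 𝓑 | B ≠ B' ∧ ((B'.dom : Set X) ∩ (B.dom : Set X)).Nonempty}.encard ≤ d

variable {𝓑 : CSP X q} {d : ℕ}

/-- All constraints through x meet one another at x; the extra 1 counts the one whose neighbors are
bounded. -/
theorem DegreeLE.encard_mem_dom_le (hd : 𝓑.DegreeLE d) (x : X) :
    {B ∈ 𝓑 | x ∈ B.dom}.encard ≤ (d + 1 : ℕ) := by
  rcases Set.eq_empty_or_nonempty {B ∈ 𝓑 | x ∈ B.dom} with h | ⟨B, hB, hx⟩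
  · rw [h]; simp
  · have h1 : {B ∈ 𝓑 | x ∈ B.dom} ⊆
        insert B {B' ∈ 𝓑 | B ≠ B' ∧ ((B'.dom : Set X) ∩ (B.dom : Set X)).Nonempty} := by
      rintro B' ⟨hB', hx'⟩
      by_cases h : B = B'
      · exact Or.inl h.symm
      · exact Or.inr ⟨hB', h, x, hx', hx⟩
    refine (Set.encard_le_encard h1).trans ((Set.encard_insert_le _ _).trans ?_)
    push_cast
    gcongr
    exact hd B hB

theorem DegreeLE.finite_mem_dom (hd : 𝓑.DegreeLE d) (x : X) : {B ∈ 𝓑 | x ∈ B.dom}.Finite :=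
  Set.finite_of_encard_le_coe (hd.encard_mem_dom_le x)

theorem DegreeLE.finite_neighbors (hd : 𝓑.DegreeLE d) (x : X) : {y | 𝓑.graph.Adj x y}.Finite := by
  refine ((hd.finite_mem_dom x).biUnion fun B _ => B.dom.finite_toSet).subset ?_
  rintro y ⟨_, B, hB, hx, hy⟩
  exact Set.mem_biUnion (show B ∈ {B ∈ 𝓑 | x ∈ B.dom} from ⟨hB, hx⟩) hy

open scoped Classical in
theorem DegreeLE.card_filter_le (hd : 𝓑.DegreeLE d) {𝓕 : Finset (Constraint X q)}
    (h𝓕 : ∀ B ∈ 𝓕, B ∈ 𝓑) {B : Constraint X q} (hB : B ∈ 𝓕) :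
    (𝓕.filter fun B' => B' ≠ B ∧ ¬ Disjoint B'.dom B.dom).card ≤ d := by
  have h1 : ((𝓕.filter fun B' => B' ≠ B ∧ ¬ Disjoint B'.dom B.dom : Finset _) :
      Set (Constraint X q)) ⊆
      {B' ∈ 𝓑 | B ≠ B' ∧ ((B'.dom : Set X) ∩ (B.dom : Set X)).Nonempty} := by
    intro B' hB'
    obtain ⟨h1, h2, h3⟩ := Finset.mem_filter.1 (Finset.mem_coe.1 hB')
    obtain ⟨x, hx, hx'⟩ := Finset.not_disjoint_iff.1 h3
    exact ⟨h𝓕 _ h1, h2.symm, x, hx, hx'⟩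
  have h2 := (Set.encard_le_encard h1).trans (hd B (h𝓕 B hB))
  rw [Set.encard_coe_eq_coe_finsetCard] at h2
  exact_mod_cast h2

theorem eq_or_adj_of_mem_dom {B : Constraint X q} (hB : B ∈ 𝓑) {x y : X} (hx : x ∈ B.dom)
    (hy : y ∈ B.dom) : x = y ∨ 𝓑.graph.Adj x y :=
  (eq_or_ne x y).imp_right fun h => ⟨h, B, hB, hx, hy⟩

theorem joined_of_mem_dom {B : Constraint X q} (hB : B ∈ 𝓑) {U : Set X} {x y : X}
    (hx : x ∈ B.dom) (hy : y ∈ B.dom) (hxU : x ∈ U) (hyU : y ∈ U) : Joined 𝓑.graph U x y := by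
  obtain rfl | h := eq_or_adj_of_mem_dom hB hx hy
  · exact Relation.ReflTransGen.refl
  · exact Relation.ReflTransGen.single ⟨h, hxU, hyU⟩

/-- The symmetric Lovász Local Lemma for infinite CSPs. -/
theorem DegreeLE.exists_isSolution (hd : 𝓑.DegreeLE d) (hq : 0 < q) {a : ℝ}
    (ha : ∀ B ∈ 𝓑, (B.bad.card : ℝ) / (q : ℝ) ^ B.dom.card ≤ a)
    (had : a * (Real.exp 1 * (d + 1)) ≤ 1) : ∃ f : X → Fin q, 𝓑.IsSolution f := by
  classical
  -- Compactness of the product space reduces to finite subfamilies; for these the finite lemma is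
  -- applied with nothing colored beforehand and b = 1.
  let K : 𝓑 → Set (X → Fin q) := fun B => {f | ¬ B.1.Violates f}
  have hK : ∀ B, IsClosed (K B) := by
    intro B
    have h1 : Continuous fun (f : X → Fin q) (x : {x // x ∈ B.1.dom}) => f x.1 := by fun_prop
    exact (Set.toFinite {ψ | ψ ∉ B.1.bad}).isClosed.preimage h1
  have h2 := isCompact_univ.inter_iInter_nonempty K hK fun u => by
    let 𝓕 : Finset (Constraint X q) := u.map (Function.Embedding.subtype _)
    have h𝓕 : ∀ B ∈ 𝓕, B ∈ 𝓑 := by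
      intro B hB
      obtain ⟨B', _, rfl⟩ := Finset.mem_map.1 hB
      exact B'.2
    let C : Finset X := 𝓕.biUnion fun B => B.dom
    obtain ⟨c, hc⟩ := Constraint.exists_overlay_condProb_lt hq 𝓕 (fun _ => ⟨0, hq⟩) (S := ∅)
      (C := C) (fun _ _ h => h) d one_pos
      (fun B hB => by rw [Constraint.condProb_empty]; exact ha B (h𝓕 B hB)) had
      (fun B hB => by convert hd.card_filter_le h𝓕 hB)
    refine ⟨Constraint.overlay (fun _ => ⟨0, hq⟩) C c, trivial, Set.mem_iInter₂.2 fun B hB => ?_⟩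
    have hB' : B.1 ∈ 𝓕 := Finset.mem_map.2 ⟨B, hB, rfl⟩
    exact B.1.not_violates_of_condProb_lt_one
      (fun x hx => Or.inr (Finset.mem_biUnion.2 ⟨B.1, hB', hx⟩)) (hc B.1 hB')
  obtain ⟨f, -, hf⟩ := h2
  exact ⟨f, fun B hB => Set.mem_iInter.1 hf ⟨B, hB⟩⟩

/-! ### Borel neighborhoods and one Borel round of coloring. -/

variable [MeasurableSpace X] [StandardBorelSpace X]

theorem DegreeLE.measurableSet_nbhd (hd : 𝓑.DegreeLE d) (hq : 0 < q) (h𝓑 : 𝓑.IsBorel) {Z : Set X}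
    (hZ : MeasurableSet Z) : MeasurableSet (nbhd 𝓑.graph Z) := by
  have h1 : nbhd 𝓑.graph Z = Z ∪ {x | ∃ B ∈ 𝓑, x ∈ B.dom ∧ ∃ y ∈ B.dom, y ∈ Z} := by
    ext x
    constructor
    · rintro (hx | ⟨y, hy, _, B, hB, hxB, hyB⟩)
      · exact Or.inl hx
      · exact Or.inr ⟨B, hB, hxB, y, hyB, hy⟩
    · rintro (hx | ⟨B, hB, hxB, y, hyB, hy⟩)
      · exact Or.inl hx
      · obtain rfl | h := eq_or_adj_of_mem_dom hB hxB hyB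
        · exact Or.inl hy
        · exact Or.inr ⟨y, hy, h⟩
  rw [h1]
  refine hZ.union (measurableSet_exists_mem_dom hq h𝓑 (d + 1) hd.encard_mem_dom_le
    (fun _ B => ∃ y ∈ B.dom, y ∈ Z) fun m β => ?_)
  have h2 : {z : X × InjTuple X m | ∃ y ∈ (Constraint.ofTuple z.2 β).dom, y ∈ Z} =
      ⋃ i, (fun z : X × InjTuple X m => z.2.1 i) ⁻¹' Z := by
    ext z
    rw [Set.mem_iUnion]
    constructor
    · rintro ⟨y, hy, hyZ⟩
      obtain ⟨i, rfl⟩ := InjTuple.mem_entries.1 hy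
      exact ⟨i, hyZ⟩
    · rintro ⟨i, hi⟩
      exact ⟨_, z.2.apply_mem_entries i, hi⟩
  rw [h2]
  exact MeasurableSet.iUnion fun i =>
    ((measurable_pi_apply i).comp (measurable_subtype_coe.comp measurable_snd)) hZ

/-- On a Borel set `U` whose induced graph has finite components, a partial coloring can be
extended in a Borel way with control of all conditional probabilities. -/
theorem DegreeLE.exists_measurable_condProb_lt (hd : 𝓑.DegreeLE d) (hq : 0 < q)
    (h𝓑 : 𝓑.IsBorel) {U S : Set X} (hU : MeasurableSet U) (hS : MeasurableSet S)
    (hSU : ∀ x ∈ U, x ∉ S) (hfin : ∀ x ∈ U, {y | Joined 𝓑.graph U x y}.Finite)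
    {a b : ℝ} (hb : 0 < b) (hab : a * (Real.exp 1 * (d + 1)) ≤ b) {f : X → Fin q}
    (hf : Measurable f) (ha : ∀ B ∈ 𝓑, B.condProb f S ≤ a) :
    ∃ g : X → Fin q, Measurable g ∧ ∀ B ∈ 𝓑, B.condProb g (S ∪ U) < b := by
  classical
  obtain ⟨h, hh, hext⟩ := exists_countable_extending (X := X) hq
  let F : ℕ → X → Fin q := fun n => U.piecewise (h n) f
  have hF : ∀ n, Measurable (F n) := fun n => (hh n).piecewise hU hf
  -- Z n marks the points of U on a constraint that the n-th candidate spoils; its saturation W n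
  -- collects the components of U on which candidate n fails.
  let Z : ℕ → Set X := fun n =>
    {x | ∃ B ∈ 𝓑, x ∈ B.dom ∧ b ≤ B.condProb (F n) (S ∪ U)} ∩ U
  have hZ : ∀ n, MeasurableSet (Z n) := by
    intro n
    refine (measurableSet_exists_mem_dom hq h𝓑 (d + 1) hd.encard_mem_dom_le
      (fun _ B => b ≤ B.condProb (F n) (S ∪ U)) fun m β => ?_).inter hU
    exact measurableSet_le measurable_const
      ((Constraint.measurable_condProb_ofTuple β (hF n) (hS.union hU)).comp measurable_snd)
  let W : ℕ → Set X := fun n => saturation 𝓑.graph U (Z n)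
  have hW : ∀ n, MeasurableSet (W n) := fun n =>
    measurableSet_saturation (fun _ => hd.measurableSet_nbhd hq h𝓑) hU (hZ n)
      Set.inter_subset_right
  have hex : ∀ x, ∃ n, x ∈ U → x ∉ W n := by
    intro x
    by_cases hx : x ∈ U
    swap
    · exact ⟨0, fun h => absurd h hx⟩
    let C : Finset X := (hfin x hx).toFinset
    have hC : ∀ y, y ∈ C ↔ Joined 𝓑.graph U x y := fun y => (hfin x hx).mem_toFinset
    have hCU : ∀ y ∈ C, y ∈ U := fun y hy => ((hC y).1 hy).mem hx
    let 𝓕 : Finset (Constraint X q) := C.biUnion fun y => (hd.finite_mem_dom y).toFinset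
    have h𝓕 : ∀ B, B ∈ 𝓕 ↔ ∃ y ∈ C, B ∈ 𝓑 ∧ y ∈ B.dom := by
      intro B
      simp [𝓕]
    have h𝓕' : ∀ B ∈ 𝓕, B ∈ 𝓑 := fun B hB => by
      obtain ⟨_, _, h, _⟩ := (h𝓕 B).1 hB
      exact h
    obtain ⟨c, hc⟩ := Constraint.exists_overlay_condProb_lt hq 𝓕 f (S := S) (C := C)
      (fun y hy => hSU y (hCU y hy)) d hb (fun B hB => ha B (h𝓕' B hB)) hab
      (fun B hB => by convert hd.card_filter_le h𝓕' hB)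
    obtain ⟨n, hn⟩ := hext C (Constraint.overlay f C c)
    refine ⟨n, fun _ => ?_⟩
    rintro ⟨z, ⟨⟨B, hB, hzB, hbB⟩, hzU⟩, hxz⟩
    refine absurd (hc B ((h𝓕 B).2 ⟨z, (hC z).2 hxz, hB, hzB⟩)) (not_lt.2 (hbB.trans_eq ?_))
    -- A domain is a clique of the graph, so B meets U only in the component of x. There candidate n
    -- agrees with the good coloring c.
    refine B.condProb_congr (fun y hy => ?_) fun y hy hySU => ?_
    · refine or_congr_right ⟨fun hyU => ?_, fun hyC => hCU y hyC⟩
      exact (hC y).2 (hxz.trans (joined_of_mem_dom hB hzB hy hzU hyU))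
    · by_cases hyU : y ∈ U
      · have hyC : y ∈ C := (hC y).2 (hxz.trans (joined_of_mem_dom hB hzB hy hzU hyU))
        rw [← hn y hyC]
        exact Set.piecewise_eq_of_mem _ _ _ hyU
      · rw [Constraint.overlay_of_notMem fun hyC => hyU (hCU y hyC)]
        exact Set.piecewise_eq_of_notMem _ _ _ hyU
  -- The least successful index is Borel and constant on components of U, so each constraint sees a
  -- single candidate.
  let N : X → ℕ := fun x => Nat.find (hex x)
  have hN : Measurable N := measurable_find hex fun n => by
    have : {x | x ∈ U → x ∉ W n} = (U ∩ W n)ᶜ := by ext; simp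
    rw [this]
    exact (hU.inter (hW n)).compl
  have hNspec : ∀ x ∈ U, x ∉ W (N x) := fun x => Nat.find_spec (hex x)
  have hNeq : ∀ x y, x ∈ U → y ∈ U → Joined 𝓑.graph U x y → N x = N y := by
    intro x y hx hy hxy
    refine Nat.find_congr' fun {n} => ?_
    simp only [hx, hy, forall_const]
    refine not_congr ⟨?_, ?_⟩
    · rintro ⟨z, hz, hxz⟩; exact ⟨z, hz, hxy.symm.trans hxz⟩
    · rintro ⟨z, hz, hyz⟩; exact ⟨z, hz, hxy.trans hyz⟩
  refine ⟨fun x => F (N x) x, ?_, fun B hB => ?_⟩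
  · exact (measurable_from_prod_countable_right (f := fun p : ℕ × X => F p.1 p.2) hF).comp
      (hN.prodMk measurable_id)
  · by_cases hBU : ∃ x ∈ B.dom, x ∈ U
    · obtain ⟨x, hxB, hxU⟩ := hBU
      have h1 : B.condProb (fun x => F (N x) x) (S ∪ U) = B.condProb (F (N x)) (S ∪ U) := by
        refine B.condProb_congr (fun _ _ => Iff.rfl) fun y hy _ => ?_
        by_cases hyU : y ∈ U
        · rw [hNeq x y hxU hyU (joined_of_mem_dom hB hxB hy hxU hyU)]
        · simp only [F, Set.piecewise_eq_of_notMem _ _ _ hyU]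
      rw [h1]
      by_contra! hlt
      exact hNspec x hxU ⟨x, ⟨⟨B, hB, hxB, hlt⟩, hxU⟩, Relation.ReflTransGen.refl⟩
    · push Not at hBU
      have h1 : B.condProb (fun x => F (N x) x) (S ∪ U) = B.condProb f S := by
        refine B.condProb_congr (fun y hy => or_iff_left (hBU y hy)) fun y hy _ => ?_
        exact Set.piecewise_eq_of_notMem _ _ _ (hBU y hy)
      rw [h1]
      refine (ha B hB).trans_lt ?_
      have h2 : 1 < Real.exp 1 * ((d : ℝ) + 1) := by
        have h3 := Real.add_one_lt_exp (one_ne_zero (α := ℝ))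
        nlinarith [(Nat.cast_nonneg d : (0 : ℝ) ≤ d)]
      -- A constraint that misses U keeps its probability, so a < b is needed: it follows from b > 0
      -- if a ≤ 0, and from e(d+1) > 1 otherwise.
      rcases le_or_gt a 0 with h4 | h4 <;> nlinarith

end CSP

/-! ### Splitting a hyperfinite graph into two parts with finite components -/

section Layers

open MeasureTheory Filter

variable {X : Type*}

/-- In a locally finite graph, neighborhoods of a vanishing sequence of sets vanish. -/
theorem iInter_nbhd_eq_empty {G : SimpleGraph X} (hfin : ∀ x, {y | G.Adj x y}.Finite)
    {Z : ℕ → Set X} (hZ : Antitone Z) (h : ⋂ n, Z n = ∅) : ⋂ n, nbhd G (Z n) = ∅ := by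
  classical
  have h1 : ∀ y, ∃ n, y ∉ Z n := by
    intro y
    by_contra! hy
    exact Set.eq_empty_iff_forall_notMem.1 h y (Set.mem_iInter.2 hy)
  choose n hn using h1
  rw [Set.eq_empty_iff_forall_notMem]
  intro x hx
  let T : Finset X := insert x (hfin x).toFinset
  have hT : ∀ y ∈ T, y ∉ Z (T.sup n) := fun y hy hyZ => hn y (hZ (Finset.le_sup hy) hyZ)
  rcases Set.mem_iInter.1 hx (T.sup n) with h2 | ⟨y, hy, hxy⟩
  · exact hT x (Finset.mem_insert_self _ _) h2
  · exact hT y (Finset.mem_insert_of_mem ((hfin x).mem_toFinset.2 hxy)) hy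

/-- The points that leave `V` at stage `k`. -/
def layer (V : ℕ → Set X) (k : ℕ) : Set X := (V k)ᶜ ∩ ⋂ j, ⋂ _ : j < k, V j

theorem mem_layer {V : ℕ → Set X} {k : ℕ} {x : X} :
    x ∈ layer V k ↔ x ∉ V k ∧ ∀ j < k, x ∈ V j := by
  simp [layer]

/-- Up to an invariant null set, a locally finite Borel graph with vanishing Borel separators
whose complements have finite components splits into two Borel parts with finite components. -/
theorem exists_two_parts [MeasurableSpace X] {G : SimpleGraph X}
    (hG : ∀ Z, MeasurableSet Z → MeasurableSet (nbhd G Z)) (hfin : ∀ x, {y | G.Adj x y}.Finite)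
    {A : ℕ → Set X} (hAm : ∀ n, MeasurableSet (A n)) (hA : Antitone A) (hA0 : ⋂ n, A n = ∅)
    (hAfin : ∀ n x, {y | Joined G (A n)ᶜ x y}.Finite) (μ : Measure X) [IsFiniteMeasure μ] :
    ∃ U : ℕ → Set X, (∀ r, MeasurableSet (U r)) ∧ (∀ x ∈ U 1, x ∉ U 0) ∧
      (∀ r, ∀ x ∈ U r, {y | Joined G (U r) x y}.Finite) ∧ μ (U 0 ∪ U 1)ᶜ = 0 ∧
      ∀ x y, G.Adj x y → x ∈ U 0 ∪ U 1 → y ∈ U 0 ∪ U 1 := by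
  have hIm : ∀ k n, MeasurableSet ((nbhd G)^[k] (A n)) := by
    intro k n
    induction k with
    | zero => exact hAm n
    | succ k ih => rw [Function.iterate_succ_apply']; exact hG _ ih
  have hIa : ∀ k, Antitone fun n => (nbhd G)^[k] (A n) := fun k _ _ h =>
    (nbhd_mono G).iterate k (hA h)
  have hI0 : ∀ k, ⋂ n, (nbhd G)^[k] (A n) = ∅ := by
    intro k
    induction k with
    | zero => exact hA0
    | succ k ih =>
      simp only [Function.iterate_succ_apply']
      exact iInter_nbhd_eq_empty hfin (hIa k) ih
  -- Continuity from above; the bounds are chosen summable for Borel–Cantelli.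
  have hν : ∀ k, ∃ n, μ ((nbhd G)^[k] (A n)) ≤ 2⁻¹ ^ k := by
    intro k
    have h1 := tendsto_measure_iInter_atTop (μ := μ) (fun n => (hIm k n).nullMeasurableSet)
      (hIa k) ⟨0, measure_ne_top _ _⟩
    rw [hI0, measure_empty] at h1
    exact (h1.eventually (Iic_mem_nhds (ENNReal.pow_pos (by simp) k))).exists
  choose ν hν using hν
  -- The i-th term for k + 1, after one more neighborhood, is the (i + 1)-st term for k; this gives
  -- `hVstep`.
  let V : ℕ → Set X := fun k => ⋃ i, (nbhd G)^[i] (A (ν (k + i)))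
  have hVm : ∀ k, MeasurableSet (V k) := fun k => MeasurableSet.iUnion fun i => hIm _ _
  have hVstep : ∀ k, nbhd G (V (k + 1)) ⊆ V k := by
    intro k x hx
    have key : ∀ i, x ∈ nbhd G ((nbhd G)^[i] (A (ν (k + 1 + i)))) → x ∈ V k := by
      intro i hi
      refine Set.mem_iUnion.2 ⟨i + 1, ?_⟩
      rw [Function.iterate_succ_apply', show k + (i + 1) = k + 1 + i by ring]
      exact hi
    rcases hx with hx | ⟨y, hy, hxy⟩
    · obtain ⟨i, hi⟩ := Set.mem_iUnion.1 hx
      exact key i (Or.inl hi)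
    · obtain ⟨i, hi⟩ := Set.mem_iUnion.1 hy
      exact key i (Or.inr ⟨y, hi, hxy⟩)
  have hAV : ∀ k, A (ν k) ⊆ V k := fun k x hx => Set.mem_iUnion.2 ⟨0, hx⟩
  have hadj : ∀ x y, G.Adj x y → ∀ k, x ∉ V k → y ∉ V (k + 1) := fun x y hxy k hx hy =>
    hx (hVstep k (Or.inr ⟨y, hy, hxy⟩))
  have hnull : μ {x | ∀ k, x ∈ V k} = 0 := by
    have h1 : μ {x | ∃ᶠ j in atTop, x ∈ (nbhd G)^[j] (A (ν j))} = 0 := by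
      refine measure_setOfPred_frequently_eq_zero (p := fun j x => x ∈ (nbhd G)^[j] (A (ν j))) ?_
      refine ne_top_of_le_ne_top ?_ (ENNReal.tsum_le_tsum hν)
      rw [ENNReal.tsum_geometric]
      simp
    refine measure_mono_null (fun x hx => ?_) h1
    -- A point of V k lies in an i-th neighborhood of A (ν (k + i)), hence in the (k + i)-th one,
    -- and k is arbitrary.
    refine frequently_atTop.2 fun k => ?_
    obtain ⟨i, hi⟩ := Set.mem_iUnion.1 (hx k)
    refine ⟨k + i, Nat.le_add_right _ _, ?_⟩
    rw [Function.iterate_add_apply]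
    exact Function.id_le_iterate_of_id_le (fun Z => subset_nbhd G Z) k _ hi
  have hLm : ∀ k, MeasurableSet (layer V k) := fun k =>
    (hVm k).compl.inter (MeasurableSet.iInter fun j => MeasurableSet.iInter fun _ => hVm j)
  have hLle : ∀ x k l, x ∉ V k → x ∈ layer V l → l ≤ k := fun x k l hk hl => by
    by_contra! h
    exact hk ((mem_layer.1 hl).2 k h)
  have hLadj : ∀ x y k l, G.Adj x y → x ∈ layer V k → y ∈ layer V l → l ≤ k + 1 :=
    fun x y k l hxy hx hy => hLle y _ _ (hadj x y hxy k (mem_layer.1 hx).1) hy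
  let U : ℕ → Set X := fun r => ⋃ k, layer V (2 * k + r)
  have hUV : ∀ x, x ∈ U 0 ∪ U 1 ↔ ∃ k, x ∉ V k := by
    classical
    intro x
    constructor
    · rintro (hx | hx) <;> obtain ⟨k, hk⟩ := Set.mem_iUnion.1 hx <;>
        exact ⟨_, (mem_layer.1 hk).1⟩
    · intro h
      have hL : x ∈ layer V (Nat.find h) :=
        mem_layer.2 ⟨Nat.find_spec h, fun j hj => not_not.1 (Nat.find_min h hj)⟩
      rcases Nat.even_or_odd' (Nat.find h) with ⟨k, hk | hk⟩ <;> rw [hk] at hL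
      · exact Or.inl (Set.mem_iUnion.2 ⟨k, hL⟩)
      · exact Or.inr (Set.mem_iUnion.2 ⟨k, hL⟩)
  refine ⟨U, fun r => MeasurableSet.iUnion fun k => hLm _, ?_, ?_, ?_, ?_⟩
  · intro x hx hx'
    obtain ⟨k, hk⟩ := Set.mem_iUnion.1 hx
    obtain ⟨l, hl⟩ := Set.mem_iUnion.1 hx'
    have h1 := hLle x _ _ (mem_layer.1 hk).1 hl
    have h2 := hLle x _ _ (mem_layer.1 hl).1 hk
    omega
  · intro r x hx
    obtain ⟨k, hk⟩ := Set.mem_iUnion.1 hx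
    refine (hAfin (ν (2 * k + r)) x).subset fun y hy => ?_
    have hsub : ∀ z ∈ layer V (2 * k + r), z ∈ (A (ν (2 * k + r)))ᶜ := fun z hz hzA =>
      (mem_layer.1 hz).1 (hAV _ hzA)
    -- Adjacent layers differ by at most 1 in index, so by parity a walk in U r never leaves its
    -- layer, which avoids A (ν (2k + r)).
    have h1 : y ∈ layer V (2 * k + r) ∧ Joined G (A (ν (2 * k + r)))ᶜ x y := by
      induction hy with
      | refl => exact ⟨hk, Relation.ReflTransGen.refl⟩
      | @tail y z _ hyz ih =>
        obtain ⟨l, hl⟩ := Set.mem_iUnion.1 hyz.2.2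
        have h2 := hLadj _ _ _ _ hyz.1 ih.1 hl
        have h3 := hLadj _ _ _ _ hyz.1.symm hl ih.1
        obtain rfl : l = k := by omega
        exact ⟨hl, ih.2.tail ⟨hyz.1, hsub _ ih.1, hsub _ hl⟩⟩
    exact h1.2
  · refine measure_mono_null (fun x hx => ?_) hnull
    by_contra! h
    refine hx ((hUV x).2 ?_)
    by_contra! h'
    exact h h'
  · intro x y hxy hx
    obtain ⟨k, hk⟩ := (hUV x).1 hx
    exact (hUV y).2 ⟨k + 1, hadj x y hxy k hk⟩

/-- A set all of whose `G`-edges lie in `H` meets components of `G` in pieces of components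
of `H`. -/
theorem finite_joined_of_componentFinite {G : SimpleGraph X} (H : G.Subgraph)
    (hH : ComponentFinite H.coe) {U : Set X} (hU : ∀ x ∈ U, ∀ y, G.Adj x y → H.Adj x y) (x : X) :
    {y | Joined G U x y}.Finite := by
  by_cases hx : x ∈ H.verts
  · refine ((hH (H.coe.connectedComponentMk ⟨x, hx⟩)).image Subtype.val).subset fun y hy => ?_
    have h1 : ∃ hy : y ∈ H.verts, H.coe.Reachable ⟨x, hx⟩ ⟨y, hy⟩ := by
      induction hy with
      | refl => exact ⟨hx, SimpleGraph.Reachable.refl _⟩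
      | @tail y z _ hyz ih =>
        obtain ⟨hy, h⟩ := ih
        have h2 : H.Adj y z := hU y hyz.2.1 z hyz.1
        have h3 : H.coe.Adj ⟨y, hy⟩ ⟨z, H.edge_vert h2.symm⟩ := h2
        exact ⟨H.edge_vert h2.symm, h.trans h3.reachable⟩
    obtain ⟨hy, h⟩ := h1
    exact ⟨⟨y, hy⟩, SimpleGraph.ConnectedComponent.sound h.symm, rfl⟩
  · refine (Set.finite_singleton x).subset fun y hy => ?_
    induction hy with
    | refl => rfl
    | @tail y z _ hyz ih =>
      obtain rfl : y = x := ih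
      exact absurd (H.edge_vert (hU y hyz.2.1 z hyz.1)) hx

theorem measurableSet_subgraph_adj [MeasurableSpace X] {G : SimpleGraph X} {H : G.Subgraph}
    (hH : IsBorelSubgraph H) : MeasurableSet {z : X × X | H.Adj z.1 z.2} := by
  have he := MeasurableEmbedding.subtype_coe hH.1
  have h1 : {z : X × X | H.Adj z.1 z.2} =
      Prod.map (Subtype.val : H.verts → X) (Subtype.val : H.verts → X) ''
        {z : H.verts × H.verts | H.coe.Adj z.1 z.2} := by
    ext ⟨x, y⟩
    constructor
    · intro h
      exact ⟨(⟨x, H.edge_vert h⟩, ⟨y, H.edge_vert h.symm⟩), h, rfl⟩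
    · rintro ⟨⟨x', y'⟩, h, h'⟩
      obtain ⟨rfl, rfl⟩ := Prod.ext_iff.1 h'
      exact h
  rw [h1]
  exact (he.prodMap he).measurableSet_image.2 hH.2

end Layers

/-! ### From hyperfiniteness to the two parts. -/

namespace CSP

open MeasureTheory

variable {X : Type*} [MeasurableSpace X] [StandardBorelSpace X] {q : ℕ} {𝓑 : CSP X q} {d : ℕ}

/-- The separators are the vertices with an edge missing from `H n`. They vanish because each vertex
has finitely many edges, all eventually in `H n`; off them, walks stay in the finite components of
`H n`. -/
theorem DegreeLE.exists_two_parts (hd : 𝓑.DegreeLE d) (hq : 0 < q) (h𝓑 : 𝓑.IsBorel)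
    (h_hyp : IsHyperfinite 𝓑.graph) (μ : Measure X) [IsFiniteMeasure μ] :
    ∃ U : ℕ → Set X, (∀ r, MeasurableSet (U r)) ∧ (∀ x ∈ U 1, x ∉ U 0) ∧
      (∀ r, ∀ x ∈ U r, {y | Joined 𝓑.graph (U r) x y}.Finite) ∧ μ (U 0 ∪ U 1)ᶜ = 0 ∧
      ∀ x y, 𝓑.graph.Adj x y → x ∈ U 0 ∪ U 1 → y ∈ U 0 ∪ U 1 := by
  classical
  obtain ⟨-, H, hmono, hH, htop⟩ := h_hyp
  let A : ℕ → Set X := fun n => {x | ∃ y, 𝓑.graph.Adj x y ∧ ¬ (H n).Adj x y}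
  refine BorelCSP.exists_two_parts (A := A) (fun Z => hd.measurableSet_nbhd hq h𝓑)
    hd.finite_neighbors ?_ ?_ ?_ ?_ μ
  · intro n
    have h1 : A n = {x | ∃ B ∈ 𝓑, x ∈ B.dom ∧ ∃ y ∈ B.dom, x ≠ y ∧ ¬ (H n).Adj x y} := by
      ext x
      constructor
      · rintro ⟨y, ⟨hxy, B, hB, hx, hy⟩, h⟩
        exact ⟨B, hB, hx, y, hy, hxy, h⟩
      · rintro ⟨B, hB, hx, y, hy, hxy, h⟩
        exact ⟨y, ⟨hxy, B, hB, hx, hy⟩, h⟩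
    rw [h1]
    refine measurableSet_exists_mem_dom hq h𝓑 (d + 1) hd.encard_mem_dom_le
      (fun x B => ∃ y ∈ B.dom, x ≠ y ∧ ¬ (H n).Adj x y) fun m β => ?_
    have h2 : {z : X × InjTuple X m | ∃ y ∈ (Constraint.ofTuple z.2 β).dom,
        z.1 ≠ y ∧ ¬ (H n).Adj z.1 y} =
        ⋃ i, (fun z : X × InjTuple X m => (z.1, z.2.1 i)) ⁻¹'
          ({w | w.1 = w.2}ᶜ ∩ {w | (H n).Adj w.1 w.2}ᶜ) := by
      ext z
      rw [Set.mem_iUnion]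
      constructor
      · rintro ⟨y, hy, h⟩
        obtain ⟨i, rfl⟩ := InjTuple.mem_entries.1 hy
        exact ⟨i, h⟩
      · rintro ⟨i, hi⟩
        exact ⟨_, z.2.apply_mem_entries i, hi⟩
    rw [h2]
    refine MeasurableSet.iUnion fun i => ?_
    refine (measurable_fst.prodMk ((measurable_pi_apply i).comp
      (measurable_subtype_coe.comp measurable_snd))) ?_
    exact (measurableSet_eq_fun measurable_fst measurable_snd).compl.inter
      (measurableSet_subgraph_adj (hH n).1).compl
  · rintro m n hmn x ⟨y, hxy, h⟩
    exact ⟨y, hxy, fun h' => h ((hmono hmn).2 h')⟩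
  · rw [Set.eq_empty_iff_forall_notMem]
    intro x hx
    have h1 : ∀ y, ∃ n, 𝓑.graph.Adj x y → (H n).Adj x y := by
      intro y
      by_cases hxy : 𝓑.graph.Adj x y
      · have h2 : (⨆ n, H n).Adj x y := by rw [htop]; exact hxy
        obtain ⟨n, hn⟩ := SimpleGraph.Subgraph.iSup_adj.1 h2
        exact ⟨n, fun _ => hn⟩
      · exact ⟨0, fun h => absurd h hxy⟩
    choose n hn using h1
    obtain ⟨y, hxy, h⟩ := Set.mem_iInter.1 hx ((hd.finite_neighbors x).toFinset.sup n)
    refine h ((hmono (Finset.le_sup ?_)).2 (hn y hxy))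
    exact (hd.finite_neighbors x).mem_toFinset.2 hxy
  · intro n x
    refine finite_joined_of_componentFinite (H n) (hH n).2 (fun x hx y hxy => ?_) x
    by_contra h
    exact hx ⟨y, hxy, h⟩

end CSP

end BorelCSP

/-! ### The two rounds of coloring. -/

open BorelCSP MeasureTheory in
theorem corollary1p18 {X : Type*} [MeasurableSpace X] [StandardBorelSpace X]
    (q : ℕ) (hq : 0 < q) (𝓑 : CSP X q) (h_borel : 𝓑.IsBorel)
    (h_hyp : IsHyperfinite 𝓑.graph)
    (h_lll : 𝓑.p * ((𝓑.d : ENNReal) + 1) ^ 2 ≤ ENNReal.ofReal (Real.exp (-2)))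
    (μ : Measure X) [IsProbabilityMeasure μ] :
    ∃ f : X → Fin q, 𝓑.IsSolution f ∧ ∀ i : Fin q, NullMeasurableSet (f ⁻¹' {i}) μ := by
  classical
  have hprob : ∀ B ∈ 𝓑, B.prob ≤ 𝓑.p := fun B hB => le_iSup₂_of_le B hB le_rfl
  have hq' : (0 : ℝ) < q := by exact_mod_cast hq
  rcases eq_or_ne 𝓑.d ⊤ with htop | hfin
  · have hp : 𝓑.p = 0 := by
      by_contra hp
      rw [htop] at h_lll
      simp [ENNReal.mul_top hp] at h_lll
    refine ⟨fun _ => ⟨0, hq⟩, fun B hB hv => ?_,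
      fun i => (measurable_const (measurableSet_singleton i)).nullMeasurableSet⟩
    have h1 := hprob B hB
    rw [hp, Constraint.prob_eq_ofReal hq, nonpos_iff_eq_zero, ENNReal.ofReal_eq_zero] at h1
    have h2 : (0 : ℝ) < B.bad.card := by exact_mod_cast Finset.card_pos.2 ⟨_, hv⟩
    have h3 : 0 < (B.bad.card : ℝ) / (q : ℝ) ^ B.dom.card := by positivity
    linarith
  obtain ⟨d, hdd⟩ := ENat.ne_top_iff_exists.1 hfin
  have hd : 𝓑.DegreeLE d := fun B hB => by
    rw [hdd]
    exact le_iSup₂_of_le (f := fun B _ => Set.encard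
      {B' ∈ 𝓑 | B ≠ B' ∧ ((B'.dom : Set X) ∩ (B.dom : Set X)).Nonempty}) B hB le_rfl
  set c : ℝ := Real.exp 1 * (d + 1) with hc
  have hc1 : 1 ≤ c := by
    have h3 := Real.add_one_lt_exp (one_ne_zero (α := ℝ))
    nlinarith [(Nat.cast_nonneg d : (0 : ℝ) ≤ d)]
  have ha : ∀ B ∈ 𝓑, (B.bad.card : ℝ) / (q : ℝ) ^ B.dom.card ≤ 1 / c ^ 2 := by
    intro B hB
    have h1 : B.prob * ((d : ENNReal) + 1) ^ 2 ≤ ENNReal.ofReal (Real.exp (-2)) := by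
      refine le_trans ?_ h_lll
      rw [← hdd]
      gcongr
      · exact hprob B hB
      · simp
    have h2 : ((d : ENNReal) + 1) ^ 2 = ENNReal.ofReal (((d : ℝ) + 1) ^ 2) := by
      rw [ENNReal.ofReal_pow (by positivity), ENNReal.ofReal_add (by positivity) (by positivity)]
      simp
    rw [Constraint.prob_eq_ofReal hq, h2, ← ENNReal.ofReal_mul (by positivity),
      ENNReal.ofReal_le_ofReal_iff (Real.exp_pos _).le] at h1
    rw [le_div_iff₀ (by positivity), hc, mul_pow, ← Real.exp_nat_mul]
    calc (B.bad.card : ℝ) / (q : ℝ) ^ B.dom.card * (Real.exp ((2 : ℕ) * 1) * (d + 1) ^ 2)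
        = Real.exp 2 * ((B.bad.card : ℝ) / (q : ℝ) ^ B.dom.card * ((d : ℝ) + 1) ^ 2) := by
          push_cast; ring_nf
      _ ≤ Real.exp 2 * Real.exp (-2) := by gcongr
      _ = 1 := by rw [← Real.exp_add]; simp
  have hc0 : 0 < c := by linarith
  have h1c : 1 / c ^ 2 * c = 1 / c := by field_simp
  obtain ⟨f₀, hf₀⟩ := hd.exists_isSolution hq ha
    (by rw [← hc, h1c, div_le_one hc0]; exact hc1)
  obtain ⟨U, hUm, hU01, hUfin, hUnull, hUinv⟩ := hd.exists_two_parts hq h_borel h_hyp μ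
  obtain ⟨g₀, hg₀, hg₀B⟩ := hd.exists_measurable_condProb_lt hq h_borel (hUm 0)
    MeasurableSet.empty (fun _ _ => Set.notMem_empty _) (hUfin 0) (a := 1 / c ^ 2) (b := 1 / c)
    (by positivity) (by rw [← hc, h1c]) (f := fun _ => ⟨0, hq⟩) measurable_const
    (fun B hB => by rw [Constraint.condProb_empty]; exact ha B hB)
  rw [Set.empty_union] at hg₀B
  obtain ⟨g, hg, hgB⟩ := hd.exists_measurable_condProb_lt hq h_borel (hUm 1) (hUm 0) hU01
    (hUfin 1) (a := 1 / c) one_pos (by rw [← hc]; exact (one_div_mul_cancel hc0.ne').le) hg₀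
    (fun B hB => (hg₀B B hB).le)
  -- The union is closed under adjacency, so no constraint straddles it. The solution f₀ need not be
  -- measurable, but it is used only on a null set.
  refine ⟨(U 0 ∪ U 1).piecewise g f₀, fun B hB => ?_, fun i => ?_⟩
  · by_cases hBU : ∃ x ∈ B.dom, x ∈ U 0 ∪ U 1
    · obtain ⟨x, hxB, hx⟩ := hBU
      have h1 : ∀ y ∈ B.dom, y ∈ U 0 ∪ U 1 := by
        intro y hy
        obtain rfl | h := CSP.eq_or_adj_of_mem_dom hB hxB hy
        exacts [hx, hUinv x y h hx]
      have h2 : (fun x : {x // x ∈ B.dom} => (U 0 ∪ U 1).piecewise g f₀ x) = fun x => g x.1 :=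
        funext fun y => Set.piecewise_eq_of_mem _ _ _ (h1 y y.2)
      rw [Constraint.Violates, h2]
      exact B.not_violates_of_condProb_lt_one h1 (hgB B hB)
    · push Not at hBU
      have h2 : (fun x : {x // x ∈ B.dom} => (U 0 ∪ U 1).piecewise g f₀ x) = fun x => f₀ x.1 :=
        funext fun y => Set.piecewise_eq_of_notMem _ _ _ (hBU y y.2)
      rw [Constraint.Violates, h2]
      exact hf₀ B hB
  · have h1 : g =ᵐ[μ] (U 0 ∪ U 1).piecewise g f₀ := by
      refine measure_mono_null (fun x hx => ?_) hUnull
      intro hxU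
      exact hx (Set.piecewise_eq_of_mem _ _ _ hxU).symm
    exact (hg.aemeasurable.congr h1).nullMeasurable (measurableSet_singleton i)
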